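/- Let $n,m\ge 1$ and $N\ge n+m$ be integers, $V=\mathbb{C}^N$, $T_{n,m}=V^{\otimes n}\otimes (V^*)^{\otimes m}$ and $S_{n,m}=S_n\times S_m\subset S_{n+m}$. The group $S_{n,m}$ acts on $T_{n,m}$ by $$\rho_N(\alpha\times\beta)(v_1\otimes\dots\otimes v_n\otimes\omega_1\otimes\dots\otimes\omega_m)=v_{\alpha^{-1}(1)}\otimes\dots\otimes v_{\alpha^{-1}(n)}\otimes\omega_{\beta^{-1}(1)}\otimes\dots\otimes\omega_{\beta^{-1}(m)},$$ and $g\in U(N)$ acts by $v\mapsto gv$ on each factor $V$ and by $\omega\mapsto\omega\circ g^{-1}$ on each factor $V^*$. Let $\overset{\circ}{T}_{n,m}\subset T_{n,m}$ be the subspace of traceless tensors, the intersection of the kernels of all contractions of a factor $V$ with a factor $V^*$; it is stable under both actions. Let $P_N^{n,m}$ be the orthogonal projection of $T_{n,m}$ onto $\overset{\circ}{T}_{n,m}$ for the standard inner product. For $k\ge 1$ let $\Omega_k^N=\sum_{\sigma\in S_k}\mathrm{Tr}_{V^{\otimes k}}(\rho_N(\sigma^{-1}))\,\sigma\in\mathbb{C}[S_k]$,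 and let $\mathrm{Wg}_k^N=(\Omega_k^N)^{-1}$ be the Weingarten function, which is defined whenever $\Omega_k^N$ is invertible. Let $$\Omega_{n,m}^N=\sum_{\sigma\in S_{n,m}}\mathrm{Tr}_{\overset{\circ}{T}_{n,m}}(\rho_N(\sigma^{-1}))\,\sigma\in\mathbb{C}[S_{n,m}].$$ A walled Brauer diagram is a perfect matching of the vertices consisting of a top and a bottom row of $n+m$ vertices each, with a wall between the first $n$ and the last $m$ positions, in which two vertices of the same row are matched only if they are on different sides of the wall and two vertices of different rows only if they are on the same side. The walled Brauer algebra $\mathcal{B}_{n,m}(N)$ has the diagrams as a basis, with product $\pi\cdot\mu=N^{l(\pi,\mu)}c(\pi,\mu)$, where $c(\pi,\mu)$ is the concatenation of $\pi$ on top of $\mu$ and $l(\pi,\mu)$ is the number of closed loops removed. It acts on $T_{n,m}$ through a map $\rho_N$: the coefficient of $\rho_N(\pi)$ from one vector of the standard basis (put on the bottom row) to another (put on the top row) is $1$ if the indices at the two ends of each strand of $\pi$ agree, and $0$ otherwise. The algebra $\mathbb{C}[S_{n,m}]$ is identified with the span of the permutation diagrams, $\sigma$ joining each bottom vertex $v$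 to the top vertex $\sigma(v)$. Let $\theta:\mathcal{B}_{n,m}(N)\to\mathbb{C}[S_{n+m}]$ be the linear isomorphism that maps a diagram to the permutation obtained by exchanging top and bottom vertices in the last $m$ positions. Then: 1. $\Omega_{n+m}^N$ is invertible in $\mathbb{C}[S_{n+m}]$, so that $\mathrm{Wg}_{n+m}^N$ is defined; $\Omega_{n,m}^N$ is central and invertible in $\mathbb{C}[S_{n,m}]$, with inverse $$\mathrm{Wg}_{n,m}^N:=(\Omega_{n,m}^N)^{-1}=\sum_{\alpha\times\beta\in S_{n,m}}\mathrm{Wg}_{n+m}^N(\alpha\times\beta)\;\alpha\times\beta .$$ 2. Every endomorphism $T$ of $\overset{\circ}{T}_{n,m}$ that commutes with $U(N)$ is $\rho_N(\kappa_T)|_{\overset{\circ}{T}_{n,m}}$ for a unique $\kappa_T\in\mathbb{C}[S_{n,m}]$, and $$\kappa_T=\mathrm{Wg}_{n,m}^N*m_T,\qquad m_T=\sum_{\sigma\in S_{n,m}}\mathrm{Tr}_{\overset{\circ}{T}_{n,m}}(T\rho_N(\sigma^{-1}))\,\sigma .$$ 3. There is a unique $q_{n,m}\in\mathcal{B}_{n,m}(N)$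 with $\rho_N(q_{n,m})=P_N^{n,m}$, and $$q_{n,m}=\Omega_{n,m}^N\,\theta^{-1}(\mathrm{Wg}_{n+m}^N)=\theta^{-1}(\mathrm{Wg}_{n+m}^N)\,\Omega_{n,m}^N .$$ -/

import Mathlib

open scoped TensorProduct

noncomputable section

namespace KSW

/-! ### Group algebra, permutations of tensor factors, mixed tensors -/

/-- The action of the permutations of `ι` on `M^{⊗ι}`: `σ` sends `⨂ᵢ vᵢ` to `⨂ᵢ v_{σ⁻¹(i)}`. -/
def tensorPermRep (ι M : Type*) [AddCommGroup M] [Module ℂ M] :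
    Representation ℂ (Equiv.Perm ι) (⨂[ℂ] _ : ι, M) where
  toFun σ := (PiTensorProduct.reindex ℂ (fun _ : ι => M) σ).toLinearMap
  map_one' := by
    refine PiTensorProduct.ext (MultilinearMap.ext fun v => ?_)
    exact PiTensorProduct.reindex_tprod _ _
  map_mul' σ τ := by
    refine PiTensorProduct.ext (MultilinearMap.ext fun v => ?_)
    refine (PiTensorProduct.reindex_tprod _ _).trans (Eq.symm ?_)
    have h := PiTensorProduct.reindex_tprod (R := ℂ) (s := fun _ : ι => M) τ v
    exact (congrArg (fun t : ⨂[ℂ] _ : ι, M => PiTensorProduct.reindex ℂ (fun _ : ι => M) σ t)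
      h).trans (PiTensorProduct.reindex_tprod _ _)

theorem tensorPermRep_tprod (ι M : Type*) [AddCommGroup M] [Module ℂ M] (σ : Equiv.Perm ι)
    (v : ι → M) :
    tensorPermRep ι M σ (⨂ₜ[ℂ] i, v i) = ⨂ₜ[ℂ] i, v (σ⁻¹ i) :=
  PiTensorProduct.reindex_tprod σ v

/-- The diagonal action of a group on `M^{⊗ι}` induced by a representation on `M`. -/
def tensorPowerRep {G M : Type*} [Group G] [AddCommGroup M] [Module ℂ M] (ι : Type*)
    (ρ : Representation ℂ G M) : Representation ℂ G (⨂[ℂ] _ : ι, M) where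
  toFun g := PiTensorProduct.map fun _ => ρ g
  map_one' := by
    ext v
    simp
  map_mul' g h := by
    ext v
    simp

/-- The space `V = ℂ^N`. -/
abbrev V (N : ℕ) : Type := Fin N → ℂ

/-- The dual space `V*`. -/
abbrev VDual (N : ℕ) : Type := Module.Dual ℂ (V N)

/-- The unitary group `U(N)`. -/
abbrev U (N : ℕ) : Type := ↥(Matrix.unitaryGroup (Fin N) ℂ)

/-- The natural representation of `U(N)` on `V = ℂ^N`. -/
def naturalRep (N : ℕ) : Representation ℂ (U N) (V N) where
  toFun g := Matrix.toLin' (g : Matrix (Fin N) (Fin N) ℂ)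
  map_one' := by simp [Module.End.one_eq_id]
  map_mul' g h := by simp [Matrix.toLin'_mul, Module.End.mul_eq_comp]

/-- The space of mixed tensors `T_{n,m} = V^{⊗n} ⊗ (V*)^{⊗m}`. -/
abbrev MixedTensor (n m N : ℕ) : Type :=
  (⨂[ℂ] _ : Fin n, V N) ⊗[ℂ] (⨂[ℂ] _ : Fin m, VDual N)

/-- The group `S_{n,m} = S_n × S_m`. -/
abbrev S (n m : ℕ) : Type := Equiv.Perm (Fin n) × Equiv.Perm (Fin m)

/-- The action of `S_{n,m}` on mixed tensors by permutation of the factors. -/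
def permRep (n m N : ℕ) : Representation ℂ (S n m) (MixedTensor n m N) :=
  Representation.tprod
    ((tensorPermRep (Fin n) (V N)).comp (MonoidHom.fst _ _))
    ((tensorPermRep (Fin m) (VDual N)).comp (MonoidHom.snd _ _))

/-- The action of `U(N)` on mixed tensors: `U` acts by `v ↦ U v` on each factor `V` and by
`ω ↦ ω ∘ U⁻¹` on each factor `V*`. -/
def unitaryRep (n m N : ℕ) : Representation ℂ (U N) (MixedTensor n m N) :=
  Representation.tprod
    (tensorPowerRep (Fin n) (naturalRep N))
    (tensorPowerRep (Fin m) (naturalRep N).dual)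

/-! ### Contractions and traceless tensors -/

theorem tprod_update_self {ι M : Type*} [DecidableEq ι] [AddCommGroup M] [Module ℂ M] (i : ι)
    (v : ι → M) (z : M) :
    (⨂ₜ[ℂ] k : {k : ι // k ≠ i}, Function.update v i z k) = ⨂ₜ[ℂ] k : {k : ι // k ≠ i}, v k :=
  congrArg (PiTensorProduct.tprod ℂ) (funext fun l => Function.update_of_ne l.2 _ _)

theorem tprod_update_of_ne {ι M : Type*} [DecidableEq ι] [AddCommGroup M] [Module ℂ M] {i k : ι}
    (h : k ≠ i) (v : ι → M) (z : M) :
    (⨂ₜ[ℂ] l : {l : ι // l ≠ i}, Function.update v k z l) =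
      PiTensorProduct.tprod ℂ
        (Function.update (fun l : {l : ι // l ≠ i} => v (l : ι)) ⟨k, h⟩ z) :=
  congrArg (PiTensorProduct.tprod ℂ)
    (funext fun l => by simp [Function.update_apply, Subtype.ext_iff])

/-- Extraction of the `i`-th factor: `⨂ₖ vₖ ↦ vᵢ ⊗ ⨂_{k ≠ i} vₖ`. -/
def splitFactor {ι M : Type*} [AddCommGroup M] [Module ℂ M] (i : ι) :
    (⨂[ℂ] _ : ι, M) →ₗ[ℂ] M ⊗[ℂ] (⨂[ℂ] _ : {k : ι // k ≠ i}, M) :=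
  PiTensorProduct.lift
    { toFun := fun v => v i ⊗ₜ[ℂ] (⨂ₜ[ℂ] k : {k : ι // k ≠ i}, v k)
      map_update_add' := by
        intro _ v k x y
        by_cases h : k = i
        · subst h
          rw [tprod_update_self, tprod_update_self, tprod_update_self]
          simp only [Function.update_self, TensorProduct.add_tmul]
        · rw [tprod_update_of_ne h, tprod_update_of_ne h, tprod_update_of_ne h]
          simp only [Function.update_of_ne (Ne.symm h), MultilinearMap.map_update_add,
            TensorProduct.tmul_add]
      map_update_smul' := by
        intro _ v k c x
        by_cases h : k = i
        · subst h
          rw [tprod_update_self, tprod_update_self]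
          simp only [Function.update_self, TensorProduct.smul_tmul']
        · rw [tprod_update_of_ne h, tprod_update_of_ne h]
          simp only [Function.update_of_ne (Ne.symm h), MultilinearMap.map_update_smul,
            TensorProduct.tmul_smul] }

theorem splitFactor_tprod {ι M : Type*} [AddCommGroup M] [Module ℂ M] (i : ι) (v : ι → M) :
    splitFactor i (⨂ₜ[ℂ] k, v k) = v i ⊗ₜ[ℂ] (⨂ₜ[ℂ] k : {k : ι // k ≠ i}, v k) := by
  simp [splitFactor]

/-- The contraction `c_{i,j}`: it pairs the `i`-th vector with the `j`-th covector and removes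
both. The remaining factors keep their labels, so the target is indexed by `k ≠ i` and `l ≠ j`. -/
def contraction {n m N : ℕ} (i : Fin n) (j : Fin m) :
    MixedTensor n m N →ₗ[ℂ]
      (⨂[ℂ] _ : {k : Fin n // k ≠ i}, V N) ⊗[ℂ] (⨂[ℂ] _ : {l : Fin m // l ≠ j}, VDual N) :=
  (TensorProduct.lid ℂ _).toLinearMap ∘ₗ
    TensorProduct.map (contractRight ℂ (V N)) LinearMap.id ∘ₗ
    (TensorProduct.tensorTensorTensorComm ℂ _ _ _ _).toLinearMap ∘ₗ
    TensorProduct.map (splitFactor i) (splitFactor j)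

theorem contraction_tmul {n m N : ℕ} (i : Fin n) (j : Fin m) (v : Fin n → V N)
    (ω : Fin m → VDual N) :
    contraction i j ((⨂ₜ[ℂ] k, v k) ⊗ₜ[ℂ] (⨂ₜ[ℂ] l, ω l)) =
      ω j (v i) • ((⨂ₜ[ℂ] k : {k : Fin n // k ≠ i}, v k) ⊗ₜ[ℂ]
        (⨂ₜ[ℂ] l : {l : Fin m // l ≠ j}, ω l)) := by
  simp [contraction, splitFactor_tprod]

/-- The space of traceless tensors: the intersection of the kernels of all contractions. -/
def traceless (n m N : ℕ) : Submodule ℂ (MixedTensor n m N) :=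
  ⨅ (i : Fin n) (j : Fin m), LinearMap.ker (contraction i j)

theorem mem_traceless {n m N : ℕ} {t : MixedTensor n m N} :
    t ∈ traceless n m N ↔ ∀ i j, contraction i j t = 0 := by
  simp [traceless, Submodule.mem_iInf]

theorem mixedTensor_hom_ext {n m N : ℕ} {E : Type*} [AddCommMonoid E] [Module ℂ E]
    {f g : MixedTensor n m N →ₗ[ℂ] E}
    (h : ∀ (v : Fin n → V N) (ω : Fin m → VDual N), f ((⨂ₜ[ℂ] k, v k) ⊗ₜ[ℂ] (⨂ₜ[ℂ] l, ω l))
      = g ((⨂ₜ[ℂ] k, v k) ⊗ₜ[ℂ] (⨂ₜ[ℂ] l, ω l))) : f = g := by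
  refine TensorProduct.ext (PiTensorProduct.ext (MultilinearMap.ext fun v => ?_))
  exact PiTensorProduct.ext (MultilinearMap.ext fun ω => h v ω)

theorem traceless_perm_invariant (n m N : ℕ) (σ : S n m) :
    traceless n m N ≤ (traceless n m N).comap (permRep n m N σ) := by
  intro t ht
  rw [Submodule.mem_comap, mem_traceless]
  rw [mem_traceless] at ht
  intro i j
  let e₁ : {k : Fin n // k ≠ σ.1⁻¹ i} ≃ {k : Fin n // k ≠ i} :=
    σ.1.subtypeEquiv fun k => by
      rw [not_iff_not, Equiv.Perm.eq_inv_iff_eq]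
  let e₂ : {k : Fin m // k ≠ σ.2⁻¹ j} ≃ {k : Fin m // k ≠ j} :=
    σ.2.subtypeEquiv fun k => by
      rw [not_iff_not, Equiv.Perm.eq_inv_iff_eq]
  have key : contraction (N := N) i j ∘ₗ permRep n m N σ =
      TensorProduct.map (PiTensorProduct.reindex ℂ (fun _ => V N) e₁).toLinearMap
        (PiTensorProduct.reindex ℂ (fun _ => VDual N) e₂).toLinearMap ∘ₗ
        contraction (σ.1⁻¹ i) (σ.2⁻¹ j) := by
    apply mixedTensor_hom_ext
    intro v ω
    simp only [LinearMap.comp_apply, permRep, Representation.tprod_apply, TensorProduct.map_tmul,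
      MonoidHom.comp_apply, MonoidHom.coe_fst, MonoidHom.coe_snd, tensorPermRep_tprod,
      contraction_tmul, map_smul, LinearEquiv.coe_coe, PiTensorProduct.reindex_tprod]
    rfl
  have := congrArg (fun f => f t) key
  simpa [ht] using this

theorem traceless_unitary_invariant (n m N : ℕ) (g : U N) :
    traceless n m N ≤ (traceless n m N).comap (unitaryRep n m N g) := by
  intro t ht
  rw [Submodule.mem_comap, mem_traceless]
  rw [mem_traceless] at ht
  intro i j
  have key : contraction (N := N) i j ∘ₗ unitaryRep n m N g =
      TensorProduct.map (tensorPowerRep _ (naturalRep N) g)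
        (tensorPowerRep _ (naturalRep N).dual g) ∘ₗ contraction i j := by
    apply mixedTensor_hom_ext
    intro v ω
    have h : naturalRep N g⁻¹ (naturalRep N g (v i)) = v i := by
      rw [← Module.End.mul_apply, ← map_mul]; simp
    simp [unitaryRep, tensorPowerRep, contraction_tmul, Representation.dual_apply,
      Module.Dual.transpose_apply, h, PiTensorProduct.map_tprod]
  have := congrArg (fun f => f t) key
  simpa [ht] using this

/-- The action of `S_{n,m}` on traceless tensors. -/
def permRep₀ (n m N : ℕ) : Representation ℂ (S n m) (traceless n m N) :=
  (permRep n m N).subrepresentation (traceless n m N) (traceless_perm_invariant n m N)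

/-- The action of `U(N)` on traceless tensors. -/
def unitaryRep₀ (n m N : ℕ) : Representation ℂ (U N) (traceless n m N) :=
  (unitaryRep n m N).subrepresentation (traceless n m N) (traceless_unitary_invariant n m N)

/-! ### The standard basis and the orthogonal projection on traceless tensors -/

/-- The index set of the standard basis of `T_{n,m}`. -/
abbrev Idx (n m N : ℕ) : Type := (Fin n → Fin N) × (Fin m → Fin N)

/-- The standard basis `e_{i₁} ⊗ … ⊗ e_{iₙ} ⊗ e^{j₁} ⊗ … ⊗ e^{jₘ}` of `T_{n,m}`. -/
def stdBasis (n m N : ℕ) : Module.Basis (Idx n m N) ℂ (MixedTensor n m N) :=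
  (Basis.piTensorProduct fun _ : Fin n => Pi.basisFun ℂ (Fin N)).tensorProduct
    (Basis.piTensorProduct fun _ : Fin m => (Pi.basisFun ℂ (Fin N)).dualBasis)

/-- Coordinates in the standard basis. The standard inner product on `T_{n,m}`, for which the
standard basis is orthonormal, is the pull-back of the one of the target. -/
def coord (n m N : ℕ) : MixedTensor n m N ≃ₗ[ℂ] EuclideanSpace ℂ (Idx n m N) :=
  (stdBasis n m N).equivFun ≪≫ₗ (WithLp.linearEquiv 2 ℂ (Idx n m N → ℂ)).symm

/-- The orthogonal projection of `T_{n,m}` onto the traceless tensors, for the standard inner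
product (the tensor product of the standard inner products of `V` and `V*`). -/
def tracelessProjection (n m N : ℕ) : MixedTensor n m N →ₗ[ℂ] MixedTensor n m N :=
  (coord n m N).symm.toLinearMap ∘ₗ
    ((traceless n m N).map (coord n m N).toLinearMap).starProjection.toLinearMap ∘ₗ
    (coord n m N).toLinearMap

/-! ### Walled Brauer diagrams and the walled Brauer algebra -/

/-- The vertices of a walled Brauer diagram: `(inl i, b)` and `(inr j, b)` are the `i`-th vertex
on one side and the `j`-th vertex on the other side of the wall, in the top row when `b = true`
and in the bottom row when `b = false`. -/
abbrev Vertex (n m : ℕ) : Type := (Fin n ⊕ Fin m) × Bool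

/-- The product of the side of the wall and of the row of a vertex, as a sign:
`true` stands for `+1` and `false` for `-1`. -/
def charge {n m : ℕ} : Vertex n m → Bool
  | (Sum.inl _, b) => b
  | (Sum.inr _, b) => !b

/-- A walled Brauer diagram: an involution of the vertices that changes the charge
(in particular, it has no fixed point). -/
@[ext]
structure WalledBrauerDiagram (n m : ℕ) where
  /-- The vertex at the other end of the strand. -/
  toFun : Vertex n m → Vertex n m
  involutive : Function.Involutive toFun
  charge_toFun : ∀ x, charge (toFun x) = !charge x

instance (n m : ℕ) : Finite (WalledBrauerDiagram n m) :=
  Finite.of_injective WalledBrauerDiagram.toFun fun _ _ h => WalledBrauerDiagram.ext h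

instance (n m : ℕ) : Fintype (WalledBrauerDiagram n m) := Fintype.ofFinite _

/-- The vertices of two stacked diagrams: level `2` is the top row of the upper diagram, level `1`
is its bottom row, identified with the top row of the lower diagram, and level `0` is the bottom
row of the lower diagram. -/
abbrev StackVertex (n m : ℕ) : Type := (Fin n ⊕ Fin m) × Fin 3

/-- Position of the vertices of the upper diagram in the stack. -/
def upper {n m : ℕ} : Vertex n m → StackVertex n m := fun x => (x.1, if x.2 then 2 else 1)

/-- Position of the vertices of the lower diagram in the stack. -/
def lower {n m : ℕ} : Vertex n m → StackVertex n m := fun x => (x.1, if x.2 then 1 else 0)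

/-- Position of the vertices of the concatenated diagram in the stack. -/
def outer {n m : ℕ} : Vertex n m → StackVertex n m := fun x => (x.1, if x.2 then 2 else 0)

/-- The graph formed by the strands of `π` stacked on top of those of `μ`. -/
def stackGraph {n m : ℕ} (π μ : WalledBrauerDiagram n m) : SimpleGraph (StackVertex n m) :=
  SimpleGraph.fromRel fun a b =>
    (∃ x, a = upper x ∧ b = upper (π.toFun x)) ∨ (∃ x, a = lower x ∧ b = lower (μ.toFun x))

/-- `ν` is the concatenation `c(π, μ)` of `π` on top of `μ`: two distinct top or bottom vertices
are matched by `ν` if and only if they are connected in the stack. -/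
def IsConcat {n m : ℕ} (π μ ν : WalledBrauerDiagram n m) : Prop :=
  ∀ x y, ν.toFun x = y ↔ x ≠ y ∧ (stackGraph π μ).Reachable (outer x) (outer y)

/-- The number `l(π, μ)` of loops: the connected components of the stack that contain neither top
nor bottom vertices. -/
def loops {n m : ℕ} (π μ : WalledBrauerDiagram n m) : ℕ :=
  Nat.card {c : (stackGraph π μ).ConnectedComponent //
    ∀ x, (stackGraph π μ).connectedComponentMk (outer x) ≠ c}

/-- The space `𝓑_{n,m}` of formal complex linear combinations of walled Brauer diagrams. -/
abbrev Brauer (n m : ℕ) : Type := WalledBrauerDiagram n m →₀ ℂ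

open Classical in
/-- The product of two diagrams in the walled Brauer algebra `𝓑_{n,m}(N)`:
`π · μ = N^{l(π, μ)} c(π, μ)` (exactly one `ν` contributes to the sum). -/
def diagramMul {n m : ℕ} (N : ℕ) (π μ : WalledBrauerDiagram n m) : Brauer n m :=
  ∑ ν : WalledBrauerDiagram n m,
    if IsConcat π μ ν then Finsupp.single ν ((N : ℂ) ^ loops π μ) else 0

/-- The product of the walled Brauer algebra `𝓑_{n,m}(N)`. -/
def brauerMul {n m : ℕ} (N : ℕ) (x y : Brauer n m) : Brauer n m :=
  x.sum fun π a => y.sum fun μ b => (a * b) • diagramMul N π μ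

/-- The index carried by a vertex when the top row carries `I` and the bottom row carries `J`. -/
def label {n m N : ℕ} (I J : Idx n m N) : Vertex n m → Fin N := fun x =>
  if x.2 then Sum.elim I.1 I.2 x.1 else Sum.elim J.1 J.2 x.1

open Classical in
/-- The endomorphism `ρ_N(π)` of `T_{n,m}`. In the standard basis, its coefficient on the basis
tensor of index `I` of the image of the basis tensor of index `J` is the product over the strands
of `π` of the pairings of the basis vectors and covectors at the two ends, that is `1` if
the labels given by `I` (top row) and `J` (bottom row) agree along each strand, and `0` otherwise. -/
def diagramAction {n m : ℕ} (N : ℕ) (π : WalledBrauerDiagram n m) :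
    MixedTensor n m N →ₗ[ℂ] MixedTensor n m N :=
  Matrix.toLin (stdBasis n m N) (stdBasis n m N)
    (Matrix.of fun I J => if ∀ x, label I J (π.toFun x) = label I J x then 1 else 0)

/-- The linear extension `ρ_N : 𝓑_{n,m}(N) → End(T_{n,m})`. -/
def brauerAction {n m : ℕ} (N : ℕ) (x : Brauer n m) :
    MixedTensor n m N →ₗ[ℂ] MixedTensor n m N :=
  x.sum fun π a => a • diagramAction N π

/-- The permutation diagram of `α × β`: the bottom vertex of label `v` is matched with the top
vertex of label `(α × β)(v)`. -/
def permDiagram {n m : ℕ} (σ : S n m) : WalledBrauerDiagram n m where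
  toFun
    | (Sum.inl i, false) => (Sum.inl (σ.1 i), true)
    | (Sum.inl i, true) => (Sum.inl (σ.1⁻¹ i), false)
    | (Sum.inr j, false) => (Sum.inr (σ.2 j), true)
    | (Sum.inr j, true) => (Sum.inr (σ.2⁻¹ j), false)
  involutive := by rintro ⟨i | j, _ | _⟩ <;> simp
  charge_toFun := by rintro ⟨i | j, _ | _⟩ <;> simp [charge]

/-- The inclusion `ℂ[S_{n,m}] ⊆ 𝓑_{n,m}(N)` given by permutation diagrams. -/
def permToBrauer {n m : ℕ} (x : MonoidAlgebra ℂ (S n m)) : Brauer n m :=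
  Finsupp.mapDomain permDiagram x.coeff

/-- The row of the vertices of negative charge: the bottom row on the side of `Fin n`, the top row
on the side of `Fin m`. After the exchange of the rows on the side of `Fin m`, these vertices form
the bottom row. -/
def negRow {n m : ℕ} : Fin n ⊕ Fin m → Bool
  | Sum.inl _ => false
  | Sum.inr _ => true

theorem snd_eq_of_charge_true {n m : ℕ} {x : Vertex n m} (h : charge x = true) :
    x = (x.1, !negRow x.1) := by
  rcases x with ⟨i | j, _ | _⟩ <;> simp_all [charge, negRow]

theorem snd_eq_of_charge_false {n m : ℕ} {x : Vertex n m} (h : charge x = false) :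
    x = (x.1, negRow x.1) := by
  rcases x with ⟨i | j, _ | _⟩ <;> simp_all [charge, negRow]

theorem charge_negRow {n m : ℕ} (v : Fin n ⊕ Fin m) : charge (v, negRow v) = false := by
  rcases v with i | j <;> rfl

theorem charge_not_negRow {n m : ℕ} (v : Fin n ⊕ Fin m) : charge (v, !negRow v) = true := by
  rcases v with i | j <;> rfl

/-- The bijection `θ : 𝓓_{n,m} → S_{n+m}`, where `S_{n+m}` is the group of permutations of
`Fin n ⊕ Fin m`: exchange the top and the bottom vertices of each label in `Fin m`; all strands
then join a bottom vertex `v` to a top vertex `θ(π)(v)`. -/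
def theta (n m : ℕ) : WalledBrauerDiagram n m ≃ Equiv.Perm (Fin n ⊕ Fin m) where
  toFun π :=
    { toFun := fun v => (π.toFun (v, negRow v)).1
      invFun := fun v => (π.toFun (v, !negRow v)).1
      left_inv := fun v => by
        have h := snd_eq_of_charge_true (x := π.toFun (v, negRow v))
          (by rw [π.charge_toFun, charge_negRow]; rfl)
        simp only
        rw [← h, π.involutive]
      right_inv := fun v => by
        have h := snd_eq_of_charge_false (x := π.toFun (v, !negRow v))
          (by rw [π.charge_toFun, charge_not_negRow]; rfl)
        simp only
        rw [← h, π.involutive] }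
  invFun σ :=
    { toFun := fun x =>
        if charge x then (σ⁻¹ x.1, negRow (σ⁻¹ x.1)) else (σ x.1, !negRow (σ x.1))
      involutive := fun x => by
        cases h : charge x
        · simp only [h, Bool.false_eq_true, if_false, charge_not_negRow, if_true,
            Equiv.Perm.inv_def, Equiv.symm_apply_apply]
          exact (snd_eq_of_charge_false h).symm
        · simp only [h, Bool.false_eq_true, if_false, charge_negRow, if_true,
            Equiv.Perm.inv_def, Equiv.apply_symm_apply]
          exact (snd_eq_of_charge_true h).symm
      charge_toFun := fun x => by
        cases h : charge x
        · simp [charge_not_negRow]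
        · simp [charge_negRow] }
  left_inv π := by
    ext1
    funext x
    cases h : charge x
    · have h' := snd_eq_of_charge_true (x := π.toFun x) (by rw [π.charge_toFun, h]; rfl)
      have hx := snd_eq_of_charge_false h
      simp only [h, Bool.false_eq_true, if_false, Equiv.coe_fn_mk]
      rw [← hx, ← h']
    · have h' := snd_eq_of_charge_false (x := π.toFun x) (by rw [π.charge_toFun, h]; rfl)
      have hx := snd_eq_of_charge_true h
      simp only [h, if_true, Equiv.Perm.inv_def, Equiv.coe_fn_symm_mk]
      rw [← hx, ← h']
  right_inv σ := by
    ext v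
    simp [charge_negRow]

/-- The linear extension `θ⁻¹ : ℂ[S_{n+m}] → 𝓑_{n,m}(N)` of the inverse of `θ`. -/
def thetaInv {n m : ℕ} (x : MonoidAlgebra ℂ (Equiv.Perm (Fin n ⊕ Fin m))) : Brauer n m :=
  Finsupp.mapDomain (theta n m).symm x.coeff

/-! ### The Omega and Weingarten functions -/

/-- `∑_σ Tr(T ρ(σ⁻¹)) σ ∈ ℂ[G]`, for an endomorphism `T` of a representation `ρ` of `G`. -/
def traceElement {G W : Type*} [Group G] [Fintype G] [AddCommMonoid W] [Module ℂ W]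
    (ρ : Representation ℂ G W) (T : Module.End ℂ W) : MonoidAlgebra ℂ G :=
  ∑ σ : G, MonoidAlgebra.single σ (LinearMap.trace ℂ W (T * ρ σ⁻¹))

/-- The element `Ω^N = ∑_σ Tr_{V^{⊗ι}}(ρ_N(σ⁻¹)) σ` of the group algebra of the permutations
of `ι`; for `ι` with `k` elements this is `Ω_k^N`. -/
def omega (ι : Type) [Fintype ι] [DecidableEq ι] (N : ℕ) : MonoidAlgebra ℂ (Equiv.Perm ι) :=
  traceElement (tensorPermRep ι (V N)) 1

/-- The Weingarten function `Wg^N = (Ω^N)⁻¹` (with value `0` if `Ω^N` is not invertible). -/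
def weingarten (ι : Type) [Fintype ι] [DecidableEq ι] (N : ℕ) : MonoidAlgebra ℂ (Equiv.Perm ι) :=
  Ring.inverse (omega ι N)

/-- `Ω_{n,m}^N = ∑_σ Tr(ρ_N(σ⁻¹)) σ ∈ ℂ[S_{n,m}]`, with traces over traceless tensors. -/
def omegaMixed (n m N : ℕ) : MonoidAlgebra ℂ (S n m) :=
  traceElement (permRep₀ n m N) 1

/-- The restriction of the Weingarten function `Wg_{n+m}^N` to `S_n × S_m ⊆ S_{n+m}`. -/
def weingartenMixed (n m N : ℕ) : MonoidAlgebra ℂ (S n m) :=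
  ∑ σ : S n m, MonoidAlgebra.single σ
    ((weingarten (Fin n ⊕ Fin m) N).coeff (Equiv.sumCongr σ.1 σ.2))

end KSW

end

/-!
Let `k = n + m`. The partial transposition (`partialTranspose`) exchanges the source and target
indices of the factors `V*`, and identifies operators on `V^{⊗n} ⊗ (V*)^{⊗m}` with operators on
`V^{⊗k}`. It preserves the trace form `Tr(AB)` (`trace_partialTranspose_mul`), equivariance under
`U(N)` (`commute_partialTranspose`), and it turns the operator of a diagram `π` into the operator of
the permutation `θ(π)` (`partialTranspose_diagramAction`). Everything thus reduces to `V^{⊗k}`,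
where the inequality `k ≤ N` provides a family of distinct indices.

* The permutation operators on `V^{⊗k}` are linearly independent, and their span is stable under
  adjoints. As `Tr(A A*) > 0` for `A ≠ 0`, the trace form is nondegenerate on this span, and `Ω_k`
  is invertible (`isUnit_omega`). The permutation operators span the commutant of `U(N)`
  (`exists_eq_sum_tensorPermMatrix`): `U(N)` is Zariski dense in the space of matrices
  (`eval_eq_zero_of_unitary`), so an equivariant operator commutes with `g^{⊗k}` for every matrix
  `g`, and suitable singular matrices `g` determine all its entries.
* The operator of a diagram that is not a permutation diagram factors through a contraction, hence
  vanishes on traceless tensors (`diagramAction_eq_zero_of_mem_traceless`). The algebra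
  `ℂ[S_{n,m}]` acts faithfully on traceless tensors (`asAlgebraHom_permRep₀_injective`).

The orthogonal projection `P` on traceless tensors is equivariant, so it is `ρ(q)` for a unique `q`.
With `p = θ(q)`, the coefficient of `σ` in `Ω_k p` is `Tr(P ρ(θ⁻¹(σ⁻¹)))`, which is zero unless
`θ⁻¹(σ⁻¹)` is a permutation diagram, and is then a coefficient of `Ω_{n,m}`; as `θ` maps `α × β` to
`α × β⁻¹`, this says `Ω_k p = ∑ Ω_{n,m}(α × β) α × β⁻¹` (`omega_mul_eq_twist_omegaMixed`). Since
`Wg_k` is central, the resulting formula for `p` is the image under `θ` of both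
`Ω_{n,m} θ⁻¹(Wg_k)` and `θ⁻¹(Wg_k) Ω_{n,m}`. On traceless tensors only the permutation diagrams of
`q` act; as a permutation is conjugate to its inverse, `ρ(q) = 1` becomes `Wg_{n,m} Ω_{n,m} = 1`
there (`weingartenMixed_mul_omegaMixed`). Finally an equivariant endomorphism `T` of the traceless
tensors, extended by zero, comes from the walled Brauer algebra, so `T = ρ(κ)` with `κ ∈ ℂ[S_{n,m}]`, and
`m_T = Ω_{n,m} κ` (`traceElement_asAlgebraHom`).
-/

noncomputable section

namespace KSW

/-! ### Trace elements of group algebras -/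

section GroupAlgebra

variable {G W : Type*} [Group G] [AddCommMonoid W] [Module ℂ W]

theorem coeff_traceElement [Fintype G] (ρ : Representation ℂ G W) (T : Module.End ℂ W) (σ : G) :
    (traceElement ρ T).coeff σ = LinearMap.trace ℂ W (T * ρ σ⁻¹) := by
  classical
  simp [traceElement, MonoidAlgebra.coeff_sum, Finsupp.finsetSum_apply, Finsupp.single_apply]

theorem asAlgebraHom_eq_sum [Fintype G] (ρ : Representation ℂ G W) (κ : MonoidAlgebra ℂ G) :
    ρ.asAlgebraHom κ = ∑ σ : G, κ.coeff σ • ρ σ := by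
  rw [Representation.asAlgebraHom_def, MonoidAlgebra.lift_apply]
  exact Finsupp.sum_fintype _ _ (by simp)

/-- The coefficient of `τ` in `(∑ Tr(ρ(σ⁻¹)) σ) * κ` is `Tr(ρ(κ) ρ(τ⁻¹))`. -/
theorem traceElement_asAlgebraHom [Fintype G] (ρ : Representation ℂ G W) (κ : MonoidAlgebra ℂ G) :
    traceElement ρ (ρ.asAlgebraHom κ) = traceElement ρ 1 * κ := by
  ext σ
  rw [coeff_traceElement]
  induction κ using MonoidAlgebra.induction_linear with
  | zero => simp
  | add x y hx hy => simp [add_mul, mul_add, hx, hy]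
  | single τ c =>
    rw [MonoidAlgebra.coeff_mul_single_apply, coeff_traceElement]
    simp [mul_comm, ← map_mul]

theorem mul_comm_of_coeff_conj {x : MonoidAlgebra ℂ G}
    (h : ∀ σ τ, x.coeff (τ * σ * τ⁻¹) = x.coeff σ) (y : MonoidAlgebra ℂ G) : x * y = y * x := by
  induction y using MonoidAlgebra.induction_linear with
  | zero => simp
  | add y z hy hz => simp [add_mul, mul_add, hy, hz]
  | single τ c =>
    ext σ
    rw [MonoidAlgebra.coeff_mul_single_apply, MonoidAlgebra.coeff_single_mul_apply, mul_comm,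
      ← h (τ⁻¹ * σ) τ]
    simp

theorem coeff_conj_of_mul_comm {x : MonoidAlgebra ℂ G} (h : ∀ y, x * y = y * x) (σ τ : G) :
    x.coeff (τ * σ * τ⁻¹) = x.coeff σ := by
  have := congrArg (fun z => z.coeff (τ * σ)) (h (MonoidAlgebra.single τ 1))
  simpa [MonoidAlgebra.coeff_mul_single_apply, MonoidAlgebra.coeff_single_mul_apply] using this

theorem traceElement_one_mul_comm [Fintype G] (ρ : Representation ℂ G W) (y : MonoidAlgebra ℂ G) :
    traceElement ρ 1 * y = y * traceElement ρ 1 := by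
  refine mul_comm_of_coeff_conj (fun σ τ => ?_) y
  simp only [coeff_traceElement, one_mul, mul_inv_rev, inv_inv, map_mul]
  rw [← mul_assoc, LinearMap.trace_mul_comm, ← mul_assoc, ← map_mul]
  simp

end GroupAlgebra

theorem inverse_mul_comm {R : Type*} [Ring R] {a : R} (h : ∀ y, a * y = y * a) (y : R) :
    Ring.inverse a * y = y * Ring.inverse a := by
  by_cases ha : IsUnit a
  · obtain ⟨u, rfl⟩ := ha
    rw [Ring.inverse_unit]
    exact (show Commute (u : R) y from h y).units_inv_left
  · simp [Ring.inverse_non_unit _ ha]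

/-! ### Permutation matrices on tensor powers -/

section PermMatrix

variable {ι : Type*} [Fintype ι] {N : ℕ}

/-- The matrix of the permutation `σ` of the factors of `V^{⊗ι}` in the standard basis. -/
def tensorPermMatrix (N : ℕ) (σ : Equiv.Perm ι) : Matrix (ι → Fin N) (ι → Fin N) ℂ :=
  Matrix.of fun a b => if a ∘ σ = b then 1 else 0

theorem tensorPermMatrix_apply (σ : Equiv.Perm ι) (a b : ι → Fin N) :
    tensorPermMatrix N σ a b = if a ∘ σ = b then 1 else 0 := rfl

theorem conjTranspose_tensorPermMatrix (σ : Equiv.Perm ι) :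
    (tensorPermMatrix N σ).conjTranspose = tensorPermMatrix N σ⁻¹ := by
  ext a b
  have : b ∘ σ = a ↔ a ∘ ⇑σ⁻¹ = b :=
    ⟨fun h => by subst h; ext; simp, fun h => by subst h; ext; simp⟩
  simp [tensorPermMatrix_apply, Matrix.conjTranspose_apply, apply_ite, this]

theorem toMatrix_tensorPermRep [DecidableEq ι] (σ : Equiv.Perm ι) :
    LinearMap.toMatrix (Basis.piTensorProduct fun _ : ι => Pi.basisFun ℂ (Fin N))
      (Basis.piTensorProduct fun _ : ι => Pi.basisFun ℂ (Fin N)) (tensorPermRep ι (V N) σ) =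
      tensorPermMatrix N σ := by
  ext a b
  rw [LinearMap.toMatrix_apply, Basis.piTensorProduct_apply, tensorPermRep_tprod,
    Basis.piTensorProduct_repr_tprod_apply, tensorPermMatrix_apply]
  have : a ∘ σ = b ↔ ∀ i, a i = b (σ⁻¹ i) :=
    ⟨fun h i => by subst h; simp, fun h => by ext i; simp [h]⟩
  simp only [this, Pi.basisFun_repr, Pi.basisFun_apply, Pi.single_apply]
  rw [Finset.prod_ite_zero]
  simp

/-- For `N ≥ |ι|` the coefficients can be read off from the entries on a row with distinct
indices. -/
theorem sum_smul_tensorPermMatrix_apply [DecidableEq ι] (f : ι ↪ Fin N)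
    (c : Equiv.Perm ι → ℂ) (σ : Equiv.Perm ι) :
    (∑ τ, c τ • tensorPermMatrix N τ) f (f ∘ σ) = c σ := by
  simp only [Matrix.sum_apply, Matrix.smul_apply, tensorPermMatrix_apply, smul_eq_mul, mul_ite,
    mul_one, mul_zero]
  rw [Finset.sum_eq_single σ]
  · simp
  · intro τ _ h
    rw [if_neg]
    intro h'
    exact h (Equiv.ext fun i => f.injective (congrFun h' i))
  · simp

theorem nonempty_embedding_fin (h : Fintype.card ι ≤ N) : Nonempty (ι ↪ Fin N) :=
  Function.Embedding.nonempty_of_card_le (by simpa using h)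

open scoped ComplexOrder in
/-- If `Ω x = 0`, then `ρ(x)` is orthogonal to all permutation operators for the trace form,
hence to its own adjoint; so it vanishes, and `x = 0` as the permutation operators are linearly
independent. -/
theorem isUnit_omega (ι : Type) [Fintype ι] [DecidableEq ι] (h : Fintype.card ι ≤ N) :
    IsUnit (omega ι N) := by
  obtain ⟨f⟩ := nonempty_embedding_fin h
  have : IsArtinianRing (MonoidAlgebra ℂ (Equiv.Perm ι)) := inferInstance
  rw [IsArtinianRing.isUnit_iff_isRightRegular, isRightRegular_iff_left_eq_zero_of_mul]
  intro x hx
  rw [omega, ← traceElement_one_mul_comm, ← traceElement_asAlgebraHom] at hx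
  set b := Basis.piTensorProduct fun _ : ι => Pi.basisFun ℂ (Fin N)
  set M : Matrix (ι → Fin N) (ι → Fin N) ℂ := ∑ τ, x.coeff τ • tensorPermMatrix N τ with hM
  have hMx : LinearMap.toMatrix b b ((tensorPermRep ι (V N)).asAlgebraHom x) = M := by
    simp only [asAlgebraHom_eq_sum, map_sum, map_smul, b, toMatrix_tensorPermRep, hM]
  have htr : ∀ τ : Equiv.Perm ι, (M * tensorPermMatrix N τ⁻¹).trace = 0 := by
    intro τ
    have := congrArg (fun z => z.coeff τ) hx
    simp only [coeff_traceElement] at this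
    rw [LinearMap.trace_eq_matrix_trace ℂ b, LinearMap.toMatrix_mul, hMx,
      toMatrix_tensorPermRep] at this
    simpa using this
  have hM0 : M = 0 := by
    rw [← Matrix.trace_mul_conjTranspose_self_eq_zero_iff]
    nth_rewrite 2 [hM]
    simp [Matrix.conjTranspose_sum, Matrix.conjTranspose_smul, conjTranspose_tensorPermMatrix,
      Matrix.mul_sum, Matrix.trace_sum, Matrix.trace_smul, htr]
  ext σ
  have := sum_smul_tensorPermMatrix_apply f x.coeff σ
  rw [← hM, hM0] at this
  simpa using this.symm

end PermMatrix

/-! ### Schur–Weyl duality for the unitary group, in the stable range -/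

theorem infinite_setOf_norm_eq_one : {z : ℂ | ‖z‖ = 1}.Infinite := by
  have h : IsPreconnected (Metric.sphere (0 : ℂ) 1) :=
    isPreconnected_sphere (by rw [Complex.rank_real_complex]; norm_num) 0 1
  have h' : (Metric.sphere (0 : ℂ) 1).Infinite :=
    h.infinite_of_nontrivial ⟨1, by simp, -1, by simp, by norm_num⟩
  convert h' using 1
  ext z
  simp

section Density

variable {ι : Type*} [Fintype ι] [DecidableEq ι]

theorem diagonal_mem_unitaryGroup {z : ι → ℂ} (hz : ∀ i, ‖z i‖ = 1) :
    Matrix.diagonal z ∈ Matrix.unitaryGroup ι ℂ := by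
  rw [Matrix.mem_unitaryGroup_iff, Matrix.star_eq_conjTranspose, Matrix.diagonal_conjTranspose,
    Matrix.diagonal_mul_diagonal, ← Matrix.diagonal_one]
  congr 1
  ext i
  simp [Complex.mul_conj, Complex.normSq_eq_norm_sq, hz]

/-- A Hermitian matrix is `u D u*` with `D` diagonal and `u` unitary, and a polynomial vanishing on
the torus of diagonal unitary matrices vanishes on all diagonal matrices. -/
theorem eval_eq_zero_of_isHermitian {p : MvPolynomial (ι × ι) ℂ}
    (h : ∀ g ∈ Matrix.unitaryGroup ι ℂ, MvPolynomial.eval (fun x => g x.1 x.2) p = 0)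
    {A : Matrix ι ι ℂ} (hA : A.IsHermitian) :
    MvPolynomial.eval (fun x => A x.1 x.2) p = 0 := by
  set u : Matrix ι ι ℂ := (hA.eigenvectorUnitary : Matrix ι ι ℂ)
  let q : MvPolynomial ι ℂ := MvPolynomial.bind₁ (fun x : ι × ι =>
    ∑ k, MvPolynomial.C (u x.1 k) * MvPolynomial.X k * MvPolynomial.C (star (u x.2 k))) p
  have hq : ∀ z : ι → ℂ, MvPolynomial.eval z q =
      MvPolynomial.eval (fun x => (u * Matrix.diagonal z * star u) x.1 x.2) p := by
    intro z
    simp only [q]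
    rw [MvPolynomial.eval, MvPolynomial.eval₂Hom_bind₁]
    congr 2
    ext x
    simp [Matrix.mul_apply, Matrix.diagonal_apply, Matrix.star_apply]
  have hq0 : q = 0 := by
    refine MvPolynomial.funext_set (fun _ => {z : ℂ | ‖z‖ = 1})
      (fun _ => infinite_setOf_norm_eq_one) fun z hz => ?_
    rw [hq, map_zero]
    refine h _ (mul_mem (mul_mem hA.eigenvectorUnitary.2 ?_) (Unitary.star_mem
      hA.eigenvectorUnitary.2))
    exact diagonal_mem_unitaryGroup fun i => hz i (Set.mem_univ i)
  have := hq (RCLike.ofReal ∘ hA.eigenvalues)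
  rw [hq0, map_zero] at this
  rw [this]
  have hs := hA.spectral_theorem
  rw [Unitary.conjStarAlgAut_apply] at hs
  nth_rewrite 1 [hs]
  rfl

/-- The unitary group is Zariski dense in the space of all matrices: a polynomial in the entries
vanishing on it vanishes on the Hermitian matrices, hence on `A + t B` with `A`, `B` Hermitian and
`t` real, hence for `t = i`. -/
theorem eval_eq_zero_of_unitary {p : MvPolynomial (ι × ι) ℂ}
    (h : ∀ g ∈ Matrix.unitaryGroup ι ℂ, MvPolynomial.eval (fun x => g x.1 x.2) p = 0)
    (M : Matrix ι ι ℂ) : MvPolynomial.eval (fun x => M x.1 x.2) p = 0 := by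
  let A : Matrix ι ι ℂ := (1 / 2 : ℂ) • (M + M.conjTranspose)
  let B : Matrix ι ι ℂ := (-Complex.I / 2 : ℂ) • (M - M.conjTranspose)
  have hA : A.IsHermitian := by
    ext i j
    simp [A]
    ring
  have hB : B.IsHermitian := by
    ext i j
    simp [B]
    ring
  have hAB : A + Complex.I • B = M := by
    ext i j
    simp only [A, B, Matrix.add_apply, Matrix.smul_apply, Matrix.sub_apply, smul_eq_mul,
      Matrix.conjTranspose_apply]
    linear_combination (-1 / 2 * (M i j - star (M j i))) * Complex.I_mul_I
  let q : Polynomial ℂ := MvPolynomial.aeval (fun x : ι × ι =>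
    Polynomial.C (A x.1 x.2) + Polynomial.X * Polynomial.C (B x.1 x.2)) p
  have hq : ∀ t : ℂ, q.eval t = MvPolynomial.eval (fun x => (A + t • B) x.1 x.2) p := by
    intro t
    simp only [q]
    rw [← Polynomial.coe_aeval_eq_eval, MvPolynomial.comp_aeval_apply,
      ← MvPolynomial.coe_aeval_eq_eval]
    simp [mul_comm t]
  have hq0 : q = 0 := by
    refine Polynomial.eq_zero_of_infinite_isRoot q
      ((Set.infinite_range_of_injective Complex.ofReal_injective).mono ?_)
    rintro _ ⟨t, rfl⟩
    rw [Set.mem_ofPred_eq, Polynomial.IsRoot, hq]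
    refine eval_eq_zero_of_isHermitian h (hA.add ?_)
    ext i j
    have := congrFun (congrFun hB i) j
    simpa using Or.inl this
  have := hq Complex.I
  rw [hq0, hAB] at this
  simpa using this.symm

end Density

section SchurWeyl

variable {ι : Type*} [Fintype ι] {N : ℕ}

/-- The matrix of `g^{⊗ι}` in the standard basis. -/
def tensorPowerMatrix (ι : Type*) [Fintype ι] (g : Matrix (Fin N) (Fin N) ℂ) :
    Matrix (ι → Fin N) (ι → Fin N) ℂ :=
  Matrix.of fun a b => ∏ p, g (a p) (b p)

theorem tensorPowerMatrix_apply (g : Matrix (Fin N) (Fin N) ℂ) (a b : ι → Fin N) :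
    tensorPowerMatrix ι g a b = ∏ p, g (a p) (b p) := rfl

variable [DecidableEq ι]

theorem commute_tensorPowerMatrix_of_unitary {B : Matrix (ι → Fin N) (ι → Fin N) ℂ}
    (h : ∀ g ∈ Matrix.unitaryGroup (Fin N) ℂ,
      B * tensorPowerMatrix ι g = tensorPowerMatrix ι g * B) (M : Matrix (Fin N) (Fin N) ℂ) :
    B * tensorPowerMatrix ι M = tensorPowerMatrix ι M * B := by
  ext a b
  let P : MvPolynomial (Fin N × Fin N) ℂ :=
    (∑ c, MvPolynomial.C (B a c) * ∏ p, MvPolynomial.X (c p, b p)) -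
      ∑ c, (∏ p, MvPolynomial.X (a p, c p)) * MvPolynomial.C (B c b)
  have hP : ∀ g : Matrix (Fin N) (Fin N) ℂ, MvPolynomial.eval (fun x => g x.1 x.2) P =
      (B * tensorPowerMatrix ι g) a b - (tensorPowerMatrix ι g * B) a b := by
    intro g
    simp [P, Matrix.mul_apply, tensorPowerMatrix_apply]
  have := eval_eq_zero_of_unitary (p := P) (fun g hg => by rw [hP, h g hg, sub_self]) M
  rw [hP] at this
  exact sub_eq_zero.mp this

/-- Diagonal matrices force the entries in a column with distinct indices to vanish outside the
rows that are permutations of it. -/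
theorem exists_perm_of_apply_ne_zero {B : Matrix (ι → Fin N) (ι → Fin N) ℂ}
    (h : ∀ M : Matrix (Fin N) (Fin N) ℂ, B * tensorPowerMatrix ι M = tensorPowerMatrix ι M * B)
    (f : ι ↪ Fin N) {a : ι → Fin N} (ha : B a f ≠ 0) : ∃ σ : Equiv.Perm ι, f ∘ ⇑σ⁻¹ = a := by
  have key : ∀ p, ∃ p', a p' = f p := by
    intro p
    by_contra! hp
    -- The diagonal matrix that kills only `e_{f p}` gives `0 = B a f` when `f p` is not in `a`.
    let d : Fin N → ℂ := fun x => if x = f p then 0 else 1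
    have hd : ∀ c b : ι → Fin N,
        tensorPowerMatrix ι (Matrix.diagonal d) c b = if c = b then ∏ p, d (b p) else 0 := by
      intro c b
      by_cases hcb : c = b
      · simp [tensorPowerMatrix_apply, hcb]
      · rw [if_neg hcb]
        obtain ⟨i, hi⟩ := Function.ne_iff.mp hcb
        exact Finset.prod_eq_zero (Finset.mem_univ i) (Matrix.diagonal_apply_ne _ hi)
    have h1 := congrFun (congrFun (h (Matrix.diagonal d)) a) f
    have h2 : ∏ q, d (f q) = 0 := Finset.prod_eq_zero (Finset.mem_univ p) (by simp [d])
    have h3 : ∏ q, d (a q) = 1 := Finset.prod_eq_one fun q _ => by simp [d, hp q]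
    simp only [Matrix.mul_apply, hd, mul_ite, mul_zero, ite_mul, zero_mul, Finset.sum_ite_eq',
      Finset.sum_ite_eq, Finset.mem_univ, if_true, h2] at h1
    rw [h3, one_mul] at h1
    exact ha h1.symm
  choose s hs using key
  have hinj : Function.Injective s := fun p q hpq => f.injective (by rw [← hs, ← hs, hpq])
  refine ⟨Equiv.ofBijective s (Finite.injective_iff_bijective.mp hinj), ?_⟩
  ext p
  obtain ⟨q, rfl⟩ := (Finite.injective_iff_bijective.mp hinj).2 p
  have : (Equiv.ofBijective s (Finite.injective_iff_bijective.mp hinj))⁻¹ (s q) = q :=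
    Equiv.ofBijective_symm_apply_apply _ _ _
  simp only [Function.comp_apply]
  rw [this, hs]

/-- Schur–Weyl duality for `|ι| ≤ N`. With `f` a family of distinct indices, the entry at `(a, b)`
of an equivariant matrix is computed from its column `f` by means of the (non-invertible) matrix
that sends `e_{f p}` to `e_{b p}`. -/
theorem exists_eq_sum_tensorPermMatrix (hN : Fintype.card ι ≤ N)
    {B : Matrix (ι → Fin N) (ι → Fin N) ℂ}
    (h : ∀ g ∈ Matrix.unitaryGroup (Fin N) ℂ,
      B * tensorPowerMatrix ι g = tensorPowerMatrix ι g * B) :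
    ∃ c : Equiv.Perm ι → ℂ, B = ∑ σ, c σ • tensorPermMatrix N σ := by
  classical
  obtain ⟨f⟩ := nonempty_embedding_fin hN
  have h' := commute_tensorPowerMatrix_of_unitary h
  refine ⟨fun σ => B (f ∘ ⇑σ⁻¹) f, ?_⟩
  ext a b
  let g : Matrix (Fin N) (Fin N) ℂ :=
    Matrix.of fun x y => if ∃ p, y = f p ∧ x = b p then 1 else 0
  have hg : ∀ x p, g x (f p) = if x = b p then 1 else 0 := by
    intro x p
    simp [g, f.injective.eq_iff]
  have h1 := congrFun (congrFun (h' g) a) f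
  have h2 : (B * tensorPowerMatrix ι g) a f = B a b := by
    simp only [Matrix.mul_apply, tensorPowerMatrix_apply, hg]
    rw [Finset.sum_eq_single b]
    · simp
    · intro c _ hc
      obtain ⟨i, hi⟩ := Function.ne_iff.mp hc
      rw [Finset.prod_eq_zero (Finset.mem_univ i) (by simp [hi]), mul_zero]
    · simp
  rw [← h2, h1, Matrix.mul_apply, Matrix.sum_apply]
  symm
  refine Fintype.sum_of_injective (fun σ : Equiv.Perm ι => f ∘ ⇑σ⁻¹) ?_ _ _ ?_ ?_
  · intro σ τ hστ
    refine inv_injective (Equiv.ext fun i => f.injective (congrFun hστ i))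
  · intro c hc
    rw [mul_eq_zero]
    right
    by_contra hne
    exact hc (exists_perm_of_apply_ne_zero h' f hne)
  · intro σ
    have : a ∘ σ = b ↔ ∀ i, a i = b (σ⁻¹ i) :=
      ⟨fun h i => by subst h; simp, fun h => by ext i; simp [h]⟩
    simp only [Matrix.smul_apply, tensorPermMatrix_apply, tensorPowerMatrix_apply,
      Function.comp_apply, hg, smul_eq_mul, this]
    rw [Finset.prod_ite_zero]
    simp [mul_comm]

end SchurWeyl

/-! ### Matrices of operators on mixed tensors -/

variable {n m N : ℕ}

/-- The matrix of an operator on mixed tensors in the standard basis. -/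
def mat : Module.End ℂ (MixedTensor n m N) ≃ₐ[ℂ] Matrix (Idx n m N) (Idx n m N) ℂ :=
  LinearMap.toMatrixAlgEquiv (stdBasis n m N)

theorem mat_apply (A : Module.End ℂ (MixedTensor n m N)) (I J : Idx n m N) :
    mat A I J = (stdBasis n m N).repr (A (stdBasis n m N J)) I :=
  LinearMap.toMatrixAlgEquiv_apply _ _ _ _

theorem trace_eq_trace_mat (A : Module.End ℂ (MixedTensor n m N)) :
    LinearMap.trace ℂ _ A = (mat A).trace :=
  LinearMap.trace_eq_matrix_trace ℂ (stdBasis n m N) A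

theorem stdBasis_apply (J : Idx n m N) : stdBasis n m N J =
    (⨂ₜ[ℂ] k, (Pi.single (J.1 k) 1 : V N)) ⊗ₜ[ℂ]
      (⨂ₜ[ℂ] l, (Pi.basisFun ℂ (Fin N)).dualBasis (J.2 l)) := by
  rw [stdBasis, Module.Basis.tensorProduct_apply', Basis.piTensorProduct_apply,
    Basis.piTensorProduct_apply]
  simp

theorem stdBasis_repr_tmul (v : Fin n → V N) (ω : Fin m → VDual N) (I : Idx n m N) :
    (stdBasis n m N).repr ((⨂ₜ[ℂ] k, v k) ⊗ₜ[ℂ] (⨂ₜ[ℂ] l, ω l)) I =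
      (∏ k, v k (I.1 k)) * ∏ l, ω l (Pi.single (I.2 l) 1) := by
  obtain ⟨I₁, I₂⟩ := I
  rw [stdBasis, Module.Basis.tensorProduct_repr_tmul_apply,
    Basis.piTensorProduct_repr_tprod_apply, Basis.piTensorProduct_repr_tprod_apply]
  simp [mul_comm]

theorem mat_unitaryRep (g : U N) (I J : Idx n m N) :
    mat (unitaryRep n m N g) I J =
      (∏ k, (g : Matrix (Fin N) (Fin N) ℂ) (I.1 k) (J.1 k)) *
        ∏ l, (star (g : Matrix (Fin N) (Fin N) ℂ)) (J.2 l) (I.2 l) := by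
  rw [mat_apply, stdBasis_apply]
  simp only [unitaryRep, Representation.tprod_apply, TensorProduct.map_tmul, tensorPowerRep,
    MonoidHom.coe_mk, OneHom.coe_mk, PiTensorProduct.map_tprod]
  rw [stdBasis_repr_tmul]
  simp [naturalRep, Representation.dual_apply, Module.Dual.transpose_apply]

theorem mat_diagramAction (π : WalledBrauerDiagram n m) (I J : Idx n m N) [Decidable
    (∀ x, label I J (π.toFun x) = label I J x)] :
    mat (diagramAction N π) I J =
      if ∀ x, label I J (π.toFun x) = label I J x then 1 else 0 := by
  have : mat (diagramAction N π) = LinearMap.toMatrix (stdBasis n m N) (stdBasis n m N)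
    (diagramAction N π) := rfl
  rw [this, diagramAction, LinearMap.toMatrix_toLin]
  simp only [Matrix.of_apply]
  congr

theorem mat_permRep (σ : S n m) (I J : Idx n m N) :
    mat (permRep n m N σ) I J = if I.1 ∘ σ.1 = J.1 ∧ I.2 ∘ σ.2 = J.2 then 1 else 0 := by
  rw [mat_apply, stdBasis_apply]
  simp only [permRep, Representation.tprod_apply, TensorProduct.map_tmul, MonoidHom.comp_apply,
    MonoidHom.coe_fst, MonoidHom.coe_snd, tensorPermRep_tprod]
  rw [stdBasis_repr_tmul]
  have h1 : I.1 ∘ σ.1 = J.1 ↔ ∀ i, I.1 i = J.1 (σ.1⁻¹ i) :=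
    ⟨fun h i => by rw [← h]; simp, fun h => by ext i; simp [h]⟩
  have h2 : I.2 ∘ σ.2 = J.2 ↔ ∀ i, J.2 (σ.2⁻¹ i) = I.2 i :=
    ⟨fun h i => by rw [← h]; simp, fun h => by ext i; simp [← h]⟩
  simp only [h1, h2, Pi.single_apply, Module.Basis.dualBasis_apply, Pi.basisFun_repr]
  rw [Finset.prod_ite_zero, Finset.prod_ite_zero]
  simp only [mul_ite, mul_one, mul_zero, ite_and, Finset.prod_const_one, Finset.mem_univ,
    forall_const]
  split_ifs <;> rfl

theorem diagramAction_permDiagram (σ : S n m) :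
    diagramAction N (permDiagram σ) = permRep n m N σ := by
  classical
  apply mat.injective
  ext I J
  rw [mat_diagramAction, mat_permRep]
  congr 1
  rw [eq_iff_iff]
  constructor
  · intro h
    exact ⟨funext fun i => h (Sum.inl i, false), funext fun i => h (Sum.inr i, false)⟩
  · rintro ⟨h1, h2⟩ ⟨i | j, _ | _⟩
    · exact congrFun h1 i
    · simp [permDiagram, label, ← h1]
    · exact congrFun h2 j
    · simp [permDiagram, label, ← h2]

/-! ### Partial transposition -/

/-- The exchange of the indices of the factors `V*` between the source and the target. -/
def transposeEquiv (n m N : ℕ) :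
    Idx n m N × Idx n m N ≃ (Fin n ⊕ Fin m → Fin N) × (Fin n ⊕ Fin m → Fin N) where
  toFun x := (Sum.elim x.1.1 x.2.2, Sum.elim x.2.1 x.1.2)
  invFun y := ((y.1 ∘ Sum.inl, y.2 ∘ Sum.inr), (y.2 ∘ Sum.inl, y.1 ∘ Sum.inr))
  left_inv x := rfl
  right_inv y := by simp

theorem transposeEquiv_apply (x : Idx n m N × Idx n m N) : transposeEquiv n m N x =
    (Sum.elim x.1.1 x.2.2, Sum.elim x.2.1 x.1.2) := rfl

/-- The partial transposition, from operators on `V^{⊗n} ⊗ (V*)^{⊗m}` to operators on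
`V^{⊗(n+m)}`, in the standard bases. -/
def partialTranspose : Matrix (Idx n m N) (Idx n m N) ℂ ≃ₗ[ℂ]
    Matrix (Fin n ⊕ Fin m → Fin N) (Fin n ⊕ Fin m → Fin N) ℂ where
  toFun M := Matrix.of fun a b => M (a ∘ Sum.inl, b ∘ Sum.inr) (b ∘ Sum.inl, a ∘ Sum.inr)
  map_add' _ _ := rfl
  map_smul' _ _ := rfl
  invFun M := Matrix.of fun I J => M (Sum.elim I.1 J.2) (Sum.elim J.1 I.2)
  left_inv M := rfl
  right_inv M := by ext; simp

theorem partialTranspose_apply (M : Matrix (Idx n m N) (Idx n m N) ℂ)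
    (a b : Fin n ⊕ Fin m → Fin N) : partialTranspose M a b =
      M (a ∘ Sum.inl, b ∘ Sum.inr) (b ∘ Sum.inl, a ∘ Sum.inr) := rfl

theorem trace_partialTranspose_mul (M M' : Matrix (Idx n m N) (Idx n m N) ℂ) :
    (partialTranspose M * partialTranspose M').trace = (M * M').trace := by
  simp only [Matrix.trace, Matrix.diag, Matrix.mul_apply]
  rw [← Fintype.sum_prod_type' (f := fun a b => partialTranspose M a b * partialTranspose M' b a),
    ← Fintype.sum_prod_type' (f := fun I J => M I J * M' J I)]
  exact Fintype.sum_equiv (transposeEquiv n m N).symm _ _ fun x => rfl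

theorem label_eq (a b : Fin n ⊕ Fin m → Fin N) (x : Vertex n m) :
    label (a ∘ Sum.inl, b ∘ Sum.inr) (b ∘ Sum.inl, a ∘ Sum.inr) x =
      if charge x then a x.1 else b x.1 := by
  rcases x with ⟨i | j, _ | _⟩ <;> simp [label, charge]

/-- The partial transposition turns the operator of the diagram `π` into that of the permutation
`θ(π)`. -/
theorem partialTranspose_diagramAction (π : WalledBrauerDiagram n m) :
    partialTranspose (mat (diagramAction N π)) = tensorPermMatrix N (theta n m π) := by
  classical
  ext a b
  rw [partialTranspose_apply, mat_diagramAction, tensorPermMatrix_apply]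
  congr 1
  rw [eq_iff_iff]
  simp only [label_eq, π.charge_toFun]
  have key : ∀ x, charge x = false → ((a (π.toFun x).1 = b x.1) ↔
      (a (theta n m π x.1) = b x.1)) := by
    intro x hx
    have : (theta n m π x.1) = (π.toFun x).1 := by
      conv_rhs => rw [snd_eq_of_charge_false hx]
      rfl
    rw [this]
  constructor
  · intro h
    ext v
    have h1 := h (v, negRow v)
    simp only [charge_negRow, Bool.not_false, if_true, Bool.false_eq_true, if_false] at h1
    exact congrArg Fin.val ((key _ (charge_negRow v)).1 h1)
  · intro h x
    cases hx : charge x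
    · simpa using (key x hx).2 (congrFun h x.1)
    · have h' : charge (π.toFun x) = false := by rw [π.charge_toFun, hx]; rfl
      have := (key _ h').2 (congrFun h _)
      rw [π.involutive] at this
      simpa using this.symm

theorem tensorPowerMatrix_mul {ι : Type*} [Fintype ι] [DecidableEq ι]
    (g h : Matrix (Fin N) (Fin N) ℂ) :
    tensorPowerMatrix ι (g * h) = tensorPowerMatrix ι g * tensorPowerMatrix ι h := by
  classical
  ext a b
  simp only [tensorPowerMatrix_apply, Matrix.mul_apply, Finset.prod_univ_sum,
    Fintype.piFinset_univ, Finset.prod_mul_distrib]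

theorem tensorPowerMatrix_one {ι : Type*} [Fintype ι] [DecidableEq ι] :
    tensorPowerMatrix ι (1 : Matrix (Fin N) (Fin N) ℂ) = 1 := by
  classical
  ext a b
  simp only [tensorPowerMatrix_apply, Matrix.one_apply]
  rw [Finset.prod_ite_zero]
  simp [funext_iff]

/-- For `h = g⁻¹` the two outer factors are the actions of `g` and `g⁻¹` on mixed tensors. -/
theorem partialTranspose_conj (g h : Matrix (Fin N) (Fin N) ℂ)
    (M : Matrix (Idx n m N) (Idx n m N) ℂ) :
    partialTranspose
      ((Matrix.of fun I J : Idx n m N => (∏ k, g (I.1 k) (J.1 k)) * ∏ l, h (J.2 l) (I.2 l)) * M *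
        (Matrix.of fun I J : Idx n m N => (∏ k, h (I.1 k) (J.1 k)) * ∏ l, g (J.2 l) (I.2 l))) =
      tensorPowerMatrix _ g * partialTranspose M * tensorPowerMatrix _ h := by
  ext a b
  simp only [partialTranspose_apply, Matrix.mul_apply, Finset.sum_mul]
  rw [← Fintype.sum_prod_type' , ← Fintype.sum_prod_type']
  refine Fintype.sum_equiv ((Equiv.prodComm _ _).trans
    ((transposeEquiv n m N).trans (Equiv.prodComm _ _))) _ _ ?_
  rintro ⟨⟨J₁, J₂⟩, ⟨I₁, I₂⟩⟩
  simp only [Equiv.trans_apply, Equiv.prodComm_apply, Prod.swap_prod_mk, transposeEquiv_apply,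
    tensorPowerMatrix_apply, Fintype.prod_sum_type, Matrix.of_apply,
    Sum.elim_inl, Sum.elim_inr, Sum.elim_comp_inl, Sum.elim_comp_inr, Function.comp_apply]
  ring

/-- The partial transpose of a `U(N)`-equivariant operator on mixed tensors is a `U(N)`-equivariant
operator on `V^{⊗(n+m)}`. -/
theorem commute_partialTranspose {A : Module.End ℂ (MixedTensor n m N)}
    (h : ∀ g : U N, A * unitaryRep n m N g = unitaryRep n m N g * A)
    (g : Matrix (Fin N) (Fin N) ℂ) (hg : g ∈ Matrix.unitaryGroup (Fin N) ℂ) :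
    partialTranspose (mat A) * tensorPowerMatrix _ g =
      tensorPowerMatrix _ g * partialTranspose (mat A) := by
  have h1 : unitaryRep n m N ⟨g, hg⟩ * A * unitaryRep n m N (⟨g, hg⟩ : U N)⁻¹ = A := by
    rw [← h, mul_assoc, ← map_mul]
    simp
  have h2 := congrArg (fun X => partialTranspose (mat X)) h1
  simp only [map_mul] at h2
  have h3 : mat (unitaryRep n m N (⟨g, hg⟩ : U N)) = Matrix.of fun I J : Idx n m N =>
      (∏ k, g (I.1 k) (J.1 k)) * ∏ l, star g (J.2 l) (I.2 l) := by
    ext I J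
    rw [mat_unitaryRep]
    rfl
  have h4 : mat (unitaryRep n m N (⟨g, hg⟩ : U N)⁻¹) = Matrix.of fun I J : Idx n m N =>
      (∏ k, star g (I.1 k) (J.1 k)) * ∏ l, g (J.2 l) (I.2 l) := by
    ext I J
    rw [mat_unitaryRep]
    simp
  rw [h3, h4, partialTranspose_conj] at h2
  nth_rewrite 1 [← h2]
  rw [mul_assoc, ← tensorPowerMatrix_mul, (Matrix.mem_unitaryGroup_iff').1 hg,
    tensorPowerMatrix_one, mul_one]

/-! ### The action of the walled Brauer algebra -/

theorem brauerAction_eq_sum (x : Brauer n m) :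
    brauerAction N x = ∑ π, x π • diagramAction N π :=
  Finsupp.sum_fintype _ _ (by simp)

theorem partialTranspose_brauerAction (x : Brauer n m) :
    partialTranspose (mat (brauerAction N x)) =
      ∑ σ, x ((theta n m).symm σ) • tensorPermMatrix N σ := by
  rw [brauerAction_eq_sum]
  simp only [map_sum, map_smul, partialTranspose_diagramAction]
  exact Fintype.sum_equiv (theta n m) _ _ (by simp)

theorem brauerAction_injective (hN : n + m ≤ N) :
    Function.Injective (brauerAction N : Brauer n m → _) := by
  obtain ⟨f⟩ := nonempty_embedding_fin (ι := Fin n ⊕ Fin m) (N := N) (by simpa using hN)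
  intro x y hxy
  ext π
  have h := congrArg (fun A => partialTranspose (mat A) f (f ∘ theta n m π)) hxy
  simp only [partialTranspose_brauerAction] at h
  rw [sum_smul_tensorPermMatrix_apply, sum_smul_tensorPermMatrix_apply] at h
  simpa using h

/-- Mixed Schur–Weyl duality in the stable range. -/
theorem exists_brauerAction_eq (hN : n + m ≤ N) {A : Module.End ℂ (MixedTensor n m N)}
    (h : ∀ g : U N, A * unitaryRep n m N g = unitaryRep n m N g * A) :
    ∃ x : Brauer n m, brauerAction N x = A := by
  obtain ⟨c, hc⟩ := exists_eq_sum_tensorPermMatrix (by simpa using hN)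
    (commute_partialTranspose h)
  refine ⟨Finsupp.equivFunOnFinite.symm fun π => c (theta n m π), ?_⟩
  apply mat.injective
  apply partialTranspose.injective
  rw [hc, partialTranspose_brauerAction]
  simp

/-! ### Diagrams acting on traceless tensors -/

theorem theta_permDiagram (σ : S n m) :
    theta n m (permDiagram σ) = Equiv.sumCongr σ.1 σ.2⁻¹ := by
  ext v
  rcases v with i | j <;> rfl

/-- In terms of `θ(π)`: a permutation of `Fin n ⊕ Fin m` that preserves `Fin n` also preserves
`Fin m`. -/
theorem exists_arc_of_forall_ne (π : WalledBrauerDiagram n m)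
    (hπ : ∀ σ : S n m, permDiagram σ ≠ π) :
    ∃ i j, π.toFun (Sum.inl i, false) = (Sum.inr j, false) := by
  by_contra! hne
  have hmaps : Set.MapsTo (theta n m π) (Set.range Sum.inl) (Set.range Sum.inl) := by
    rintro _ ⟨i, rfl⟩
    rcases hv : theta n m π (Sum.inl i) with k | j
    · exact ⟨k, rfl⟩
    · exfalso
      have hv' : (π.toFun (Sum.inl i, false)).1 = Sum.inr j := hv
      have h := snd_eq_of_charge_true (x := π.toFun (Sum.inl i, false))
        (by rw [π.charge_toFun]; rfl)
      rw [hv'] at h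
      exact hne i j h
  obtain ⟨⟨α, β⟩, hαβ⟩ := Equiv.Perm.mem_sumCongrHom_range_of_perm_mapsTo_inl hmaps
  refine hπ (α, β⁻¹) ((theta n m).injective ?_)
  rw [theta_permDiagram, ← hαβ]
  simp [Equiv.Perm.sumCongrHom]

/-- Changing the common value of a labelling on the two ends of a strand keeps it compatible with
all the strands. -/
theorem strands_agree_of_eq_off_strand {X Y : Type*} {f : X → X} (hf : Function.Involutive f)
    {p q : X} (hpq : f p = q) {L L' : X → Y} (h : ∀ x, x ≠ p → x ≠ q → L' x = L x)
    (hL' : L' p = L' q) (hL : ∀ x, L (f x) = L x) (x : X) : L' (f x) = L' x := by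
  by_cases hp : x = p
  · rw [hp, hpq, hL']
  by_cases hq : x = q
  · rw [hq, ← hpq, hf, hpq, hL']
  rw [h x hp hq, h (f x), hL]
  · intro h1
    exact hq (by rw [← hpq, ← h1, hf])
  · intro h1
    exact hp (hf.injective (h1.trans hpq.symm))

/-- The operator of a diagram with a horizontal strand in the bottom row does not depend on the
common value of the two indices at the ends of this strand. -/
theorem diagramAction_stdBasis_update (π : WalledBrauerDiagram n m) {i : Fin n} {j : Fin m}
    (hπ : π.toFun (Sum.inl i, false) = (Sum.inr j, false)) (J J' : Idx n m N)
    (h1 : ∀ k, k ≠ i → J'.1 k = J.1 k) (h2 : ∀ l, l ≠ j → J'.2 l = J.2 l)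
    (hJ : J.1 i = J.2 j) (hJ' : J'.1 i = J'.2 j) :
    diagramAction N π (stdBasis n m N J') = diagramAction N π (stdBasis n m N J) := by
  classical
  apply (stdBasis n m N).ext_elem
  intro I
  rw [← mat_apply, ← mat_apply, mat_diagramAction, mat_diagramAction]
  congr 1
  rw [eq_iff_iff]
  have hl : ∀ x : Vertex n m, x ≠ (Sum.inl i, false) → x ≠ (Sum.inr j, false) →
      label I J' x = label I J x := by
    rintro ⟨k | l, _ | _⟩ hx hx'
    · exact h1 k fun h => hx (by rw [h])
    · rfl
    · exact h2 l fun h => hx' (by rw [h])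
    · rfl
  constructor
  · exact strands_agree_of_eq_off_strand π.involutive hπ (fun x hx hx' => (hl x hx hx').symm) hJ
  · exact strands_agree_of_eq_off_strand π.involutive hπ hl hJ'

/-- The operator of a diagram with a horizontal strand in the bottom row factors through the
contraction of the two factors at the ends of this strand, so it vanishes on traceless tensors. -/
theorem diagramAction_eq_zero_of_mem_traceless (hN : 0 < N) (π : WalledBrauerDiagram n m)
    (hπ : ∀ σ : S n m, permDiagram σ ≠ π) {t : MixedTensor n m N} (ht : t ∈ traceless n m N) :
    diagramAction N π t = 0 := by
  classical
  obtain ⟨i, j, hij⟩ := exists_arc_of_forall_ne π hπ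
  let b := (Basis.piTensorProduct fun _ : {k : Fin n // k ≠ i} =>
    Pi.basisFun ℂ (Fin N)).tensorProduct (Basis.piTensorProduct fun _ : {l : Fin m // l ≠ j} =>
      (Pi.basisFun ℂ (Fin N)).dualBasis)
  -- The indices removed by the contraction are given the common value `0`.
  let F := b.constr ℂ fun K => diagramAction N π (stdBasis n m N
    (fun k => if h : k ≠ i then K.1 ⟨k, h⟩ else ⟨0, hN⟩,
      fun l => if h : l ≠ j then K.2 ⟨l, h⟩ else ⟨0, hN⟩))
  have key : diagramAction N π = F ∘ₗ contraction i j := by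
    refine (stdBasis n m N).ext fun J => ?_
    have hb : contraction i j (stdBasis n m N J) = (if J.1 i = J.2 j then (1 : ℂ) else 0) •
        b (fun k => J.1 k, fun l => J.2 l) := by
      rw [stdBasis_apply, contraction_tmul]
      simp only [b]
      rw [Module.Basis.tensorProduct_apply', Basis.piTensorProduct_apply,
        Basis.piTensorProduct_apply]
      simp [Pi.single_apply, eq_comm]
    rw [LinearMap.comp_apply, hb, map_smul, Module.Basis.constr_basis]
    by_cases hJ : J.1 i = J.2 j
    · rw [if_pos hJ, one_smul]
      symm
      refine diagramAction_stdBasis_update π hij _ _ ?_ ?_ hJ ?_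
      · intro k hk
        simp [hk]
      · intro l hl
        simp [hl]
      · simp
    · rw [if_neg hJ, zero_smul]
      apply (stdBasis n m N).ext_elem
      intro I
      rw [← mat_apply, mat_diagramAction, if_neg, map_zero, Finsupp.zero_apply]
      intro h
      have := h (Sum.inl i, false)
      rw [hij] at this
      exact hJ this.symm
  rw [key, LinearMap.comp_apply, mem_traceless.1 ht i j, map_zero]

theorem coe_permRep₀_apply (σ : S n m) (t : traceless n m N) :
    (permRep₀ n m N σ t : MixedTensor n m N) = permRep n m N σ t := rfl

theorem coe_asAlgebraHom_permRep₀_apply (κ : MonoidAlgebra ℂ (S n m)) (t : traceless n m N) :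
    ((permRep₀ n m N).asAlgebraHom κ t : MixedTensor n m N) =
      ∑ σ, κ.coeff σ • permRep n m N σ t := by
  simp [asAlgebraHom_eq_sum, coe_permRep₀_apply]

theorem permDiagram_injective : Function.Injective (permDiagram : S n m → _) := by
  intro σ τ h
  have h' := congrArg (theta n m) h
  rw [theta_permDiagram, theta_permDiagram] at h'
  have h1 : Equiv.Perm.sumCongrHom _ _ (σ.1, σ.2⁻¹) =
    Equiv.Perm.sumCongrHom _ _ (τ.1, τ.2⁻¹) := h'
  have h2 := Equiv.Perm.sumCongrHom_injective h1
  simp only [Prod.mk.injEq, inv_inj] at h2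
  exact Prod.ext h2.1 h2.2

/-- On traceless tensors, only the permutation diagrams contribute. -/
theorem brauerAction_apply_of_mem_traceless (hN : 0 < N) (x : Brauer n m) (t : traceless n m N) :
    brauerAction N x t = ∑ σ : S n m, x (permDiagram σ) • permRep n m N σ t := by
  classical
  rw [brauerAction_eq_sum, LinearMap.sum_apply]
  symm
  refine Fintype.sum_of_injective permDiagram permDiagram_injective _ _ ?_ ?_
  · intro π hπ
    rw [LinearMap.smul_apply, diagramAction_eq_zero_of_mem_traceless hN π
      (fun σ hσ => hπ ⟨σ, hσ⟩) t.2, smul_zero]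
  · intro σ
    rw [LinearMap.smul_apply, diagramAction_permDiagram]

theorem stdBasis_mem_traceless (f : Fin n ⊕ Fin m ↪ Fin N) :
    stdBasis n m N (f ∘ Sum.inl, f ∘ Sum.inr) ∈ traceless n m N := by
  rw [mem_traceless]
  intro i j
  rw [stdBasis_apply, contraction_tmul]
  simp

/-- The group algebra of `S_{n,m}` acts faithfully on traceless tensors when `n + m ≤ N`: a basis
tensor with distinct indices is traceless, and its images under `S_{n,m}` are linearly
independent. -/
theorem asAlgebraHom_permRep₀_injective (hN : n + m ≤ N) :
    Function.Injective (permRep₀ n m N).asAlgebraHom := by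
  obtain ⟨f⟩ := nonempty_embedding_fin (ι := Fin n ⊕ Fin m) (N := N) (by simpa using hN)
  rw [injective_iff_map_eq_zero]
  intro κ hκ
  ext τ
  have h := coe_asAlgebraHom_permRep₀_apply κ ⟨_, stdBasis_mem_traceless f⟩
  rw [hκ] at h
  have h' := congrArg (fun t => (stdBasis n m N).repr t
    (f ∘ Sum.inl ∘ ⇑τ.1⁻¹, f ∘ Sum.inr ∘ ⇑τ.2⁻¹)) h
  simp only [LinearMap.zero_apply, ZeroMemClass.coe_zero, map_zero, map_sum, map_smul,
    Finsupp.finsetSum_apply, Finsupp.smul_apply, Finsupp.zero_apply, ← mat_apply, mat_permRep] at h'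
  rw [Finset.sum_eq_single τ] at h'
  · rw [if_pos] at h'
    · simpa using h'.symm
    · constructor <;> ext <;> simp
  · intro σ _ hσ
    rw [if_neg, smul_zero]
    rintro ⟨h1, h2⟩
    apply hσ
    ext i
    · have := f.injective (congrFun h1 i)
      simp only [Sum.inl.injEq, Function.comp_apply] at this
      rw [Equiv.Perm.inv_eq_iff_eq] at this
      rw [this]
    · have := f.injective (congrFun h2 i)
      simp only [Sum.inr.injEq, Function.comp_apply] at this
      rw [Equiv.Perm.inv_eq_iff_eq] at this
      rw [this]
  · simp

/-! ### The projection on traceless tensors -/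

theorem coord_tracelessProjection (t : MixedTensor n m N) :
    coord n m N (tracelessProjection n m N t) =
      ((traceless n m N).map (coord n m N).toLinearMap).starProjection (coord n m N t) := by
  simp [tracelessProjection]

theorem tracelessProjection_mem (t : MixedTensor n m N) :
    tracelessProjection n m N t ∈ traceless n m N := by
  have h := Submodule.starProjection_apply_mem
    ((traceless n m N).map (coord n m N).toLinearMap) (coord n m N t)
  rw [← coord_tracelessProjection] at h
  obtain ⟨s, hs, hst⟩ := h
  rwa [← (coord n m N).injective hst]

theorem tracelessProjection_of_mem {t : MixedTensor n m N} (ht : t ∈ traceless n m N) :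
    tracelessProjection n m N t = t := by
  apply (coord n m N).injective
  rw [coord_tracelessProjection, Submodule.starProjection_eq_self_iff]
  exact ⟨t, ht, rfl⟩

theorem conjTranspose_mat_unitaryRep (g : U N) :
    (mat (unitaryRep n m N g)).conjTranspose = mat (unitaryRep n m N g⁻¹) := by
  ext I J
  rw [Matrix.conjTranspose_apply, mat_unitaryRep, mat_unitaryRep]
  simp

theorem ofLp_coord_apply (A : Module.End ℂ (MixedTensor n m N)) (t : MixedTensor n m N) :
    (coord n m N (A t)).ofLp = (mat A).mulVec (coord n m N t).ofLp :=
  (LinearMap.toMatrix_mulVec_repr (stdBasis n m N) (stdBasis n m N) A t).symm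

theorem inner_coord_unitaryRep (g : U N) (s t : MixedTensor n m N) :
    inner ℂ (coord n m N (unitaryRep n m N g s)) (coord n m N t) =
      inner ℂ (coord n m N s) (coord n m N (unitaryRep n m N g⁻¹ t)) := by
  rw [EuclideanSpace.inner_eq_star_dotProduct, EuclideanSpace.inner_eq_star_dotProduct,
    ofLp_coord_apply, ofLp_coord_apply, Matrix.star_mulVec, conjTranspose_mat_unitaryRep,
    dotProduct_comm, ← Matrix.dotProduct_mulVec, dotProduct_comm]

/-- `U(N)` acts unitarily and preserves the traceless tensors, hence commutes with the orthogonal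
projection. -/
theorem tracelessProjection_mul_unitaryRep (g : U N) :
    tracelessProjection n m N * unitaryRep n m N g =
      unitaryRep n m N g * tracelessProjection n m N := by
  refine LinearMap.ext fun t => ?_
  apply (coord n m N).injective
  simp only [Module.End.mul_apply]
  rw [coord_tracelessProjection]
  refine Submodule.eq_starProjection_of_mem_of_inner_eq_zero ?_ ?_
  · exact ⟨_, traceless_unitary_invariant n m N g (tracelessProjection_mem t), rfl⟩
  · rintro _ ⟨w, hw, rfl⟩
    have h : coord n m N (unitaryRep n m N g t) -
        coord n m N (unitaryRep n m N g (tracelessProjection n m N t)) =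
        coord n m N (unitaryRep n m N g (t - tracelessProjection n m N t)) := by
      rw [map_sub (unitaryRep n m N g), map_sub]
    rw [h, LinearEquiv.coe_coe, inner_coord_unitaryRep, map_sub, coord_tracelessProjection]
    exact Submodule.starProjection_inner_eq_zero _ _
      ⟨_, traceless_unitary_invariant n m N g⁻¹ hw, rfl⟩

/-! ### Products with permutation diagrams -/

theorem stackGraph_reachable_upper (π μ : WalledBrauerDiagram n m) (x : Vertex n m) :
    (stackGraph π μ).Reachable (upper x) (upper (π.toFun x)) := by
  by_cases h : upper x = upper (π.toFun x)
  · rw [← h]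
  · exact SimpleGraph.Adj.reachable ⟨h, Or.inl (Or.inl ⟨x, rfl, rfl⟩)⟩

theorem stackGraph_reachable_lower (π μ : WalledBrauerDiagram n m) (x : Vertex n m) :
    (stackGraph π μ).Reachable (lower x) (lower (μ.toFun x)) := by
  by_cases h : lower x = lower (μ.toFun x)
  · rw [← h]
  · exact SimpleGraph.Adj.reachable ⟨h, Or.inl (Or.inr ⟨x, rfl, rfl⟩)⟩

theorem toFun_ne (ν : WalledBrauerDiagram n m) (x : Vertex n m) : ν.toFun x ≠ x := by
  intro h
  have := ν.charge_toFun x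
  rw [h] at this
  cases hc : charge x <;> simp [hc] at this

/-- If every vertex `a` of the stack is connected to the outer vertex `F a`, and `F` sends the ends
of a strand to vertices that are equal or matched by `ν`, then `ν` is the concatenation and there
are no loops. -/
theorem diagramMul_eq_single {π μ ν : WalledBrauerDiagram n m} (F : StackVertex n m → Vertex n m)
    (hF : ∀ x, F (outer x) = x)
    (hupper : ∀ x, F (upper (π.toFun x)) = F (upper x) ∨
      F (upper (π.toFun x)) = ν.toFun (F (upper x)))
    (hlower : ∀ x, F (lower (μ.toFun x)) = F (lower x) ∨
      F (lower (μ.toFun x)) = ν.toFun (F (lower x)))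
    (hreach : ∀ a, (stackGraph π μ).Reachable a (outer (F a)))
    (hν : ∀ x, (stackGraph π μ).Reachable (outer x) (outer (ν.toFun x))) :
    diagramMul N π μ = Finsupp.single ν 1 := by
  classical
  have hadj : ∀ a b, (stackGraph π μ).Adj a b → F b = F a ∨ F b = ν.toFun (F a) := by
    have hsymm : ∀ a b, (F b = F a ∨ F b = ν.toFun (F a)) →
        (F a = F b ∨ F a = ν.toFun (F b)) := by
      rintro a b (h | h)
      · exact Or.inl h.symm
      · exact Or.inr (by rw [h, ν.involutive])
    rintro a b ⟨-, (⟨x, rfl, rfl⟩ | ⟨x, rfl, rfl⟩) | (⟨x, rfl, rfl⟩ | ⟨x, rfl, rfl⟩)⟩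
    · exact hupper x
    · exact hlower x
    · exact hsymm _ _ (hupper x)
    · exact hsymm _ _ (hlower x)
  have hinv : ∀ a b, (stackGraph π μ).Reachable a b → F b = F a ∨ F b = ν.toFun (F a) := by
    rintro a b ⟨w⟩
    induction w with
    | nil => exact Or.inl rfl
    | cons h _ ih =>
      rcases hadj _ _ h with h1 | h1 <;> rcases ih with h2 | h2
      · exact Or.inl (h2.trans h1)
      · exact Or.inr (by rw [h2, h1])
      · exact Or.inr (by rw [h2, h1])
      · exact Or.inl (by rw [h2, h1, ν.involutive])
  have hloops : loops π μ = 0 := by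
    rw [loops, Nat.card_eq_zero]
    left
    rw [isEmpty_subtype]
    intro c
    induction c using SimpleGraph.ConnectedComponent.ind with
    | h a =>
      push Not
      exact ⟨F a, (SimpleGraph.ConnectedComponent.sound (hreach a)).symm⟩
  have hconcat : ∀ ν' : WalledBrauerDiagram n m, IsConcat π μ ν' ↔ ν' = ν := by
    intro ν'
    constructor
    · intro h
      ext1
      funext x
      exact (h x (ν.toFun x)).2 ⟨(toFun_ne ν x).symm, hν x⟩
    · rintro rfl x y
      constructor
      · rintro rfl
        exact ⟨(toFun_ne _ x).symm, hν x⟩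
      · rintro ⟨hxy, h⟩
        have := hinv _ _ h
        rw [hF, hF] at this
        rcases this with h | h
        · exact absurd h.symm hxy
        · exact h.symm
  simp only [diagramMul, hconcat, hloops, pow_zero]
  simp

/-- The permutation `α × β` acting on the vertices of the row `b`. -/
def rowPerm (σ : S n m) (b : Bool) : Equiv.Perm (Vertex n m) where
  toFun x := if x.2 = b then (Equiv.sumCongr σ.1 σ.2 x.1, x.2) else x
  invFun x := if x.2 = b then ((Equiv.sumCongr σ.1 σ.2).symm x.1, x.2) else x
  left_inv x := by
    rcases x with ⟨v, c⟩
    by_cases h : c = b <;> simp [h]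
  right_inv x := by
    rcases x with ⟨v, c⟩
    by_cases h : c = b <;> simp [h]

theorem charge_rowPerm (σ : S n m) (b : Bool) (x : Vertex n m) :
    charge (rowPerm σ b x) = charge x := by
  rcases x with ⟨i | j, c⟩ <;> by_cases h : c = b <;> simp [rowPerm, h, charge]

/-- The diagram obtained from `μ` by moving the vertices of the row `b` by `α × β`. -/
def relabelRow (σ : S n m) (b : Bool) (μ : WalledBrauerDiagram n m) :
    WalledBrauerDiagram n m where
  toFun x := rowPerm σ b (μ.toFun ((rowPerm σ b).symm x))
  involutive x := by simp [μ.involutive _]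
  charge_toFun x := by
    rw [charge_rowPerm, μ.charge_toFun, ← charge_rowPerm σ b, Equiv.apply_symm_apply]

theorem toFun_relabelRow (σ : S n m) (b : Bool) (μ : WalledBrauerDiagram n m) (x : Vertex n m) :
    (relabelRow σ b μ).toFun (rowPerm σ b x) = rowPerm σ b (μ.toFun x) := by
  simp [relabelRow]

theorem permDiagram_toFun_false (σ : S n m) (v : Fin n ⊕ Fin m) :
    (permDiagram σ).toFun (v, false) = (Equiv.sumCongr σ.1 σ.2 v, true) := by
  rcases v with i | j <;> rfl

theorem permDiagram_toFun_true (σ : S n m) (v : Fin n ⊕ Fin m) :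
    (permDiagram σ).toFun (v, true) = ((Equiv.sumCongr σ.1 σ.2).symm v, false) := by
  rcases v with i | j <;> rfl

theorem diagramMul_permDiagram_left (σ : S n m) (μ : WalledBrauerDiagram n m) :
    diagramMul N (permDiagram σ) μ = Finsupp.single (relabelRow σ true μ) 1 := by
  -- Every vertex of the middle row is joined by `permDiagram σ` to an outer vertex.
  let F : StackVertex n m → Vertex n m := fun a =>
    if a.2 = 2 then (a.1, true) else if a.2 = 1 then (Equiv.sumCongr σ.1 σ.2 a.1, true)
      else (a.1, false)
  have hl : ∀ x, F (lower x) = rowPerm σ true x := by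
    rintro ⟨v, _ | _⟩ <;> simp [F, lower, rowPerm]
  have hreach : ∀ a, (stackGraph (permDiagram σ) μ).Reachable a (outer (F a)) := by
    rintro ⟨v, k⟩
    fin_cases k
    · exact SimpleGraph.Reachable.refl _
    · have h := stackGraph_reachable_upper (permDiagram σ) μ (v, false)
      rw [permDiagram_toFun_false] at h
      exact h
    · exact SimpleGraph.Reachable.refl _
  refine diagramMul_eq_single F ?_ ?_ ?_ hreach ?_
  · rintro ⟨v, _ | _⟩ <;> simp [F, outer]
  · rintro ⟨v, _ | _⟩ <;> left
    · rw [permDiagram_toFun_false]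
      simp [F, upper]
    · rw [permDiagram_toFun_true]
      simp [F, upper]
  · intro x
    right
    rw [hl, hl, toFun_relabelRow]
  · intro x
    obtain ⟨y, rfl⟩ := (rowPerm σ true).surjective x
    rw [toFun_relabelRow, ← hl, ← hl]
    exact ((hreach _).symm.trans (stackGraph_reachable_lower _ _ y)).trans (hreach _)

theorem diagramMul_permDiagram_right (σ : S n m) (μ : WalledBrauerDiagram n m) :
    diagramMul N μ (permDiagram σ) = Finsupp.single (relabelRow σ⁻¹ false μ) 1 := by
  -- Every vertex of the middle row is joined by `permDiagram σ` to an outer vertex.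
  let F : StackVertex n m → Vertex n m := fun a =>
    if a.2 = 2 then (a.1, true) else if a.2 = 1 then ((Equiv.sumCongr σ.1 σ.2).symm a.1, false)
      else (a.1, false)
  have hu : ∀ x, F (upper x) = rowPerm σ⁻¹ false x := by
    rintro ⟨v | v, _ | _⟩ <;> simp [F, upper, rowPerm]
  have hreach : ∀ a, (stackGraph μ (permDiagram σ)).Reachable a (outer (F a)) := by
    rintro ⟨v, k⟩
    fin_cases k
    · exact SimpleGraph.Reachable.refl _
    · have h := stackGraph_reachable_lower μ (permDiagram σ) (v, true)
      rw [permDiagram_toFun_true] at h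
      exact h
    · exact SimpleGraph.Reachable.refl _
  refine diagramMul_eq_single F ?_ ?_ ?_ hreach ?_
  · rintro ⟨v, _ | _⟩ <;> simp [F, outer]
  · intro x
    right
    rw [hu, hu, toFun_relabelRow]
  · rintro ⟨v, _ | _⟩ <;> left
    · rw [permDiagram_toFun_false]
      simp [F, lower]
    · rw [permDiagram_toFun_true]
      simp [F, lower]
  · intro x
    obtain ⟨y, rfl⟩ := (rowPerm σ⁻¹ false).surjective x
    rw [toFun_relabelRow, ← hu, ← hu]
    exact ((hreach _).symm.trans (stackGraph_reachable_upper _ _ y)).trans (hreach _)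

theorem theta_relabelRow_true (σ : S n m) (μ : WalledBrauerDiagram n m) :
    theta n m (relabelRow σ true μ) =
      Equiv.sumCongr σ.1 1 * theta n m μ * Equiv.sumCongr 1 σ.2⁻¹ := by
  have h : ∀ x : Vertex n m, charge x = true →
      (rowPerm σ true x).1 = Equiv.sumCongr σ.1 (1 : Equiv.Perm (Fin m)) x.1 := by
    rintro ⟨i | j, _ | _⟩ hx <;> simp_all [charge, rowPerm]
  have h' : ∀ v : Fin n ⊕ Fin m, (rowPerm σ true).symm (v, negRow v) =
      (Equiv.sumCongr (1 : Equiv.Perm (Fin n)) σ.2⁻¹ v, negRow v) := by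
    rintro (i | j) <;> simp [rowPerm, negRow]
  refine Equiv.ext fun v => ?_
  change (rowPerm σ true (μ.toFun ((rowPerm σ true).symm (v, negRow v)))).1 = _
  have hv : negRow v = negRow (Equiv.sumCongr (1 : Equiv.Perm (Fin n)) σ.2⁻¹ v) := by
    rcases v with i | j <;> rfl
  rw [h', hv, h _ (by rw [μ.charge_toFun, charge_negRow]; rfl)]
  rfl

theorem theta_relabelRow_false (σ : S n m) (μ : WalledBrauerDiagram n m) :
    theta n m (relabelRow σ⁻¹ false μ) =
      Equiv.sumCongr 1 σ.2⁻¹ * theta n m μ * Equiv.sumCongr σ.1 1 := by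
  have h : ∀ x : Vertex n m, charge x = true →
      (rowPerm σ⁻¹ false x).1 = Equiv.sumCongr (1 : Equiv.Perm (Fin n)) σ.2⁻¹ x.1 := by
    rintro ⟨i | j, _ | _⟩ hx <;> simp_all [charge, rowPerm]
  have h' : ∀ v : Fin n ⊕ Fin m, (rowPerm σ⁻¹ false).symm (v, negRow v) =
      (Equiv.sumCongr σ.1 (1 : Equiv.Perm (Fin m)) v, negRow v) := by
    rintro (i | j)
    · simp only [rowPerm, negRow]
      rfl
    · simp [rowPerm, negRow]
  refine Equiv.ext fun v => ?_
  change (rowPerm σ⁻¹ false (μ.toFun ((rowPerm σ⁻¹ false).symm (v, negRow v)))).1 = _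
  have hv : negRow v = negRow (Equiv.sumCongr σ.1 (1 : Equiv.Perm (Fin m)) v) := by
    rcases v with i | j <;> rfl
  rw [h', hv, h _ (by rw [μ.charge_toFun, charge_negRow]; rfl)]
  rfl

theorem thetaInv_apply (w : MonoidAlgebra ℂ (Equiv.Perm (Fin n ⊕ Fin m)))
    (π : WalledBrauerDiagram n m) : thetaInv w π = w.coeff (theta n m π) := by
  rw [thetaInv]
  conv_lhs => rw [← (theta n m).symm_apply_apply π]
  exact Finsupp.mapDomain_apply (theta n m).symm.injective _ _

theorem permToBrauer_sum {A : Type*} [AddCommMonoid A] (x : MonoidAlgebra ℂ (S n m))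
    (h : WalledBrauerDiagram n m → ℂ → A) (h0 : ∀ π, h π 0 = 0)
    (hadd : ∀ π a b, h π (a + b) = h π a + h π b) :
    (permToBrauer x).sum h = ∑ σ, h (permDiagram σ) (x.coeff σ) := by
  rw [permToBrauer, Finsupp.sum_mapDomain_index h0 hadd]
  exact Finsupp.sum_fintype _ _ fun _ => h0 _

/-- The linear map `α × β ↦ α × β⁻¹` from `ℂ[S_{n,m}]` to `ℂ[S_{n+m}]`, that is `θ` on the
permutation diagrams. -/
def twist (x : MonoidAlgebra ℂ (S n m)) : MonoidAlgebra ℂ (Equiv.Perm (Fin n ⊕ Fin m)) :=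
  ∑ σ, MonoidAlgebra.single (theta n m (permDiagram σ)) (x.coeff σ)

theorem coeff_mul_twist (w : MonoidAlgebra ℂ (Equiv.Perm (Fin n ⊕ Fin m)))
    (x : MonoidAlgebra ℂ (S n m)) (τ : Equiv.Perm (Fin n ⊕ Fin m)) :
    (w * twist x).coeff τ = ∑ σ, x.coeff σ * w.coeff (τ * (theta n m (permDiagram σ))⁻¹) := by
  simp only [twist, Finset.mul_sum, MonoidAlgebra.coeff_sum, Finsupp.finsetSum_apply,
    MonoidAlgebra.coeff_mul_single_apply, mul_comm]

theorem sum_coeff_smul_single {w : MonoidAlgebra ℂ (Equiv.Perm (Fin n ⊕ Fin m))}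
    (hw : ∀ y, w * y = y * w) {r : WalledBrauerDiagram n m → WalledBrauerDiagram n m}
    {A B : Equiv.Perm (Fin n ⊕ Fin m)} (hr : ∀ μ, theta n m (r μ) = A * theta n m μ * B)
    (π : WalledBrauerDiagram n m) :
    (∑ μ, w.coeff (theta n m μ) • (Finsupp.single (r μ) 1 : Brauer n m)) π =
      w.coeff (theta n m π * (A * B)⁻¹) := by
  classical
  rw [Finsupp.finsetSum_apply,
    Finset.sum_eq_single ((theta n m).symm (A⁻¹ * theta n m π * B⁻¹))]
  · have h : r ((theta n m).symm (A⁻¹ * theta n m π * B⁻¹)) = π := by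
      apply (theta n m).injective
      rw [hr]
      simp [mul_assoc]
    rw [h, ← coeff_conj_of_mul_comm hw _ A]
    simp [mul_assoc]
  · intro μ _ hμ
    rw [Finsupp.smul_apply, Finsupp.single_apply, if_neg, smul_zero]
    rintro rfl
    apply hμ
    rw [hr]
    simp [mul_assoc]
  · simp

/-- For a central `w`, the multiplication of `θ⁻¹(w)` by `α × β` on the left amounts to the
multiplication of `w` by `α × β⁻¹`: indeed `θ` turns it into `α` on the left and `β⁻¹` on the
right. -/
theorem brauerMul_permToBrauer_thetaInv {w : MonoidAlgebra ℂ (Equiv.Perm (Fin n ⊕ Fin m))}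
    (hw : ∀ y, w * y = y * w) (x : MonoidAlgebra ℂ (S n m)) :
    brauerMul N (permToBrauer x) (thetaInv w) = thetaInv (w * twist x) := by
  ext π
  rw [thetaInv_apply, coeff_mul_twist, brauerMul, permToBrauer_sum _ _ (by simp)
    (by simp [add_mul, add_smul, Finsupp.sum_add]), Finsupp.finsetSum_apply]
  refine Finset.sum_congr rfl fun σ _ => ?_
  have h := sum_coeff_smul_single hw (theta_relabelRow_true σ) π
  rw [theta_permDiagram, Finsupp.sum_fintype _ _ (by simp)]
  simp only [diagramMul_permDiagram_left, thetaInv_apply, mul_smul, ← Finset.smul_sum]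
  rw [Finsupp.smul_apply, h, Equiv.Perm.sumCongr_mul]
  simp

theorem brauerMul_thetaInv_permToBrauer {w : MonoidAlgebra ℂ (Equiv.Perm (Fin n ⊕ Fin m))}
    (hw : ∀ y, w * y = y * w) (x : MonoidAlgebra ℂ (S n m)) :
    brauerMul N (thetaInv w) (permToBrauer x) = thetaInv (w * twist x) := by
  ext π
  have hswap : brauerMul N (thetaInv w) (permToBrauer x) = (permToBrauer x).sum fun μ b =>
      (thetaInv w).sum fun π a => (b * a) • diagramMul N π μ := by
    rw [brauerMul, Finsupp.sum_comm]
    simp only [mul_comm]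
  rw [thetaInv_apply, coeff_mul_twist, hswap, permToBrauer_sum _ _ (by simp)
    (by simp [add_mul, add_smul, Finsupp.sum_add]), Finsupp.finsetSum_apply]
  refine Finset.sum_congr rfl fun σ _ => ?_
  have h := sum_coeff_smul_single hw (theta_relabelRow_false σ) π
  rw [theta_permDiagram, Finsupp.sum_fintype _ _ (by simp)]
  simp only [diagramMul_permDiagram_right, thetaInv_apply, mul_smul, ← Finset.smul_sum]
  rw [Finsupp.smul_apply, h, Equiv.Perm.sumCongr_mul]
  simp

/-! ### The Weingarten function of mixed tensors -/

theorem weingarten_mul_comm (ι : Type) [Fintype ι] [DecidableEq ι] (N : ℕ)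
    (y : MonoidAlgebra ℂ (Equiv.Perm ι)) : weingarten ι N * y = y * weingarten ι N :=
  inverse_mul_comm (traceElement_one_mul_comm _) y

theorem coeff_weingarten_congr {ι : Type} [Fintype ι] [DecidableEq ι] {σ τ : Equiv.Perm ι}
    (h : IsConj σ τ) : (weingarten ι N).coeff σ = (weingarten ι N).coeff τ := by
  obtain ⟨c, rfl⟩ := isConj_iff.1 h
  rw [coeff_conj_of_mul_comm (weingarten_mul_comm ι N)]

theorem coeff_weingartenMixed (σ : S n m) : (weingartenMixed n m N).coeff σ =
    (weingarten (Fin n ⊕ Fin m) N).coeff (Equiv.sumCongr σ.1 σ.2) := by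
  classical
  simp [weingartenMixed, MonoidAlgebra.coeff_sum, Finsupp.finsetSum_apply, Finsupp.single_apply]

theorem isConj_sumCongr {ι κ : Type*} {α : Equiv.Perm ι} {β β' : Equiv.Perm κ}
    (h : IsConj β β') : IsConj (Equiv.sumCongr α β) (Equiv.sumCongr α β') := by
  obtain ⟨c, rfl⟩ := isConj_iff.1 h
  refine isConj_iff.2 ⟨Equiv.sumCongr 1 c, ?_⟩
  rw [Equiv.Perm.sumCongr_mul, Equiv.Perm.sumCongr_inv, Equiv.Perm.sumCongr_mul]
  simp

/-- Since a permutation is conjugate to its inverse, restricting `Wg` along `α × β ↦ α × β⁻¹`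
gives the same result as restricting it to `S_n × S_m`. -/
theorem coeff_weingarten_mul_twist (x : MonoidAlgebra ℂ (S n m)) (σ : S n m) :
    (weingarten (Fin n ⊕ Fin m) N * twist x).coeff (theta n m (permDiagram σ)) =
      (weingartenMixed n m N * x).coeff σ := by
  have hx : weingartenMixed n m N * x =
      ∑ τ, weingartenMixed n m N * MonoidAlgebra.single τ (x.coeff τ) := by
    rw [← Finset.mul_sum]
    congr 1
    conv_lhs => rw [← MonoidAlgebra.sum_coeff_single x]
    exact Finsupp.sum_fintype _ _ (by simp)
  rw [coeff_mul_twist, hx, MonoidAlgebra.coeff_sum, Finsupp.finsetSum_apply]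
  refine Finset.sum_congr rfl fun τ _ => ?_
  rw [MonoidAlgebra.coeff_mul_single_apply, coeff_weingartenMixed, mul_comm, theta_permDiagram,
    theta_permDiagram, Equiv.Perm.sumCongr_inv, Equiv.Perm.sumCongr_mul]
  congr 1
  refine coeff_weingarten_congr (isConj_sumCongr ?_)
  rw [Equiv.Perm.isConj_iff_cycleType_eq, ← Equiv.Perm.cycleType_inv]
  have : (σ.2⁻¹ * τ.2⁻¹⁻¹)⁻¹ = τ.2⁻¹ * (σ * τ⁻¹).2 * τ.2⁻¹⁻¹ := by
    simp [mul_assoc]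
  rw [this, Equiv.Perm.cycleType_conj]

theorem asAlgebraHom_of_brauerAction (hN : 0 < N) {x : Brauer n m} {κ : MonoidAlgebra ℂ (S n m)}
    (h : ∀ σ, κ.coeff σ = x (permDiagram σ)) (t : traceless n m N) :
    ((permRep₀ n m N).asAlgebraHom κ t : MixedTensor n m N) = brauerAction N x t := by
  rw [brauerAction_apply_of_mem_traceless hN, coe_asAlgebraHom_permRep₀_apply]
  simp only [h]

theorem trace_tracelessProjection_mul_diagramAction_permDiagram (σ : S n m) :
    LinearMap.trace ℂ _ (tracelessProjection n m N * diagramAction N (permDiagram σ)) =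
      LinearMap.trace ℂ _ (permRep₀ n m N σ) := by
  rw [diagramAction_permDiagram, LinearMap.trace_mul_comm]
  have hf : ∀ t, (permRep n m N σ * tracelessProjection n m N) t ∈ traceless n m N := fun t =>
    traceless_perm_invariant n m N σ (tracelessProjection_mem t)
  have htr := LinearMap.trace_restrict_eq_of_forall_mem (R := ℂ) (M := MixedTensor n m N)
    (traceless n m N) (permRep n m N σ * tracelessProjection n m N) hf
  refine htr.symm.trans ?_
  congr 1
  refine LinearMap.ext fun t => Subtype.ext ?_
  rw [coe_permRep₀_apply]
  change permRep n m N σ (tracelessProjection n m N t) = _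
  rw [tracelessProjection_of_mem t.2]

theorem trace_tracelessProjection_mul_diagramAction (hN : 0 < N) {π : WalledBrauerDiagram n m}
    (hπ : ∀ σ : S n m, permDiagram σ ≠ π) :
    LinearMap.trace ℂ _ (tracelessProjection n m N * diagramAction N π) = 0 := by
  have h : diagramAction N π * tracelessProjection n m N = 0 :=
    LinearMap.ext fun t => by
      rw [Module.End.mul_apply, LinearMap.zero_apply]
      exact diagramAction_eq_zero_of_mem_traceless hN π hπ (tracelessProjection_mem t)
  rw [LinearMap.trace_mul_comm, h]
  exact map_zero _

theorem coeff_omegaMixed (σ : S n m) :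
    (omegaMixed n m N).coeff σ = LinearMap.trace ℂ _ (permRep₀ n m N σ⁻¹) := by
  rw [omegaMixed, coeff_traceElement, one_mul]

/-- The Weingarten calculus for the projection on traceless tensors: if `P = ρ(θ⁻¹(p))`, the
coefficient of `σ` in `Ω p` is the trace of `P ρ(θ⁻¹(σ⁻¹))`, which is a trace over traceless tensors
if `θ⁻¹(σ⁻¹)` is a permutation diagram, and zero otherwise. -/
theorem omega_mul_eq_twist_omegaMixed (hN : 0 < N)
    {p : MonoidAlgebra ℂ (Equiv.Perm (Fin n ⊕ Fin m))}
    (hp : brauerAction N (thetaInv p) = tracelessProjection n m N) :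
    omega (Fin n ⊕ Fin m) N * p = twist (omegaMixed n m N) := by
  classical
  let b := Basis.piTensorProduct fun _ : Fin n ⊕ Fin m => Pi.basisFun ℂ (Fin N)
  have hmat : LinearMap.toMatrix b b
      ((tensorPermRep (Fin n ⊕ Fin m) (V N)).asAlgebraHom p) =
      partialTranspose (mat (tracelessProjection n m N)) := by
    rw [← hp, partialTranspose_brauerAction]
    simp only [asAlgebraHom_eq_sum, map_sum, map_smul, b, toMatrix_tensorPermRep, thetaInv_apply,
      Equiv.apply_symm_apply]
  have key : ∀ π : WalledBrauerDiagram n m,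
      (omega (Fin n ⊕ Fin m) N * p).coeff (theta n m π)⁻¹ =
        LinearMap.trace ℂ _ (tracelessProjection n m N * diagramAction N π) := by
    intro π
    rw [omega, ← traceElement_asAlgebraHom, coeff_traceElement, inv_inv,
      LinearMap.trace_eq_matrix_trace ℂ b, LinearMap.toMatrix_mul, hmat, toMatrix_tensorPermRep,
      ← partialTranspose_diagramAction, trace_partialTranspose_mul, ← map_mul,
      trace_eq_trace_mat]
  have hinv : ∀ τ : S n m, theta n m (permDiagram τ⁻¹) = (theta n m (permDiagram τ))⁻¹ := by
    intro τ
    rw [theta_permDiagram, theta_permDiagram, Equiv.Perm.sumCongr_inv]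
    rfl
  ext σ
  obtain ⟨π, hπ⟩ := (theta n m).surjective σ⁻¹
  obtain rfl : (theta n m π)⁻¹ = σ := by rw [hπ, inv_inv]
  rw [key]
  simp only [twist, MonoidAlgebra.coeff_sum, Finsupp.finsetSum_apply, MonoidAlgebra.coeff_single,
    Finsupp.single_apply, coeff_omegaMixed]
  by_cases h : ∃ τ : S n m, permDiagram τ = π
  · obtain ⟨τ, rfl⟩ := h
    rw [trace_tracelessProjection_mul_diagramAction_permDiagram, Finset.sum_eq_single τ⁻¹]
    · simp [hinv]
    · intro τ' _ hτ'
      rw [if_neg]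
      intro h
      rw [← hinv] at h
      exact hτ' (permDiagram_injective ((theta n m).injective h))
    · simp
  · push Not at h
    rw [trace_tracelessProjection_mul_diagramAction hN h]
    symm
    refine Finset.sum_eq_zero fun τ _ => if_neg fun hτ => h τ⁻¹ ?_
    apply (theta n m).injective
    rw [hinv, hτ, inv_inv]

theorem eq_thetaInv_of_brauerAction_eq (hN : 0 < N) (hNk : n + m ≤ N) {q : Brauer n m}
    (hq : brauerAction N q = tracelessProjection n m N) :
    q = thetaInv (weingarten (Fin n ⊕ Fin m) N * twist (omegaMixed n m N)) := by
  let p : MonoidAlgebra ℂ (Equiv.Perm (Fin n ⊕ Fin m)) :=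
    MonoidAlgebra.ofCoeff (Finsupp.equivFunOnFinite.symm fun σ => q ((theta n m).symm σ))
  have hpq : thetaInv p = q := by
    ext π
    rw [thetaInv_apply]
    simp [p]
  rw [← omega_mul_eq_twist_omegaMixed (p := p) hN (by rw [hpq, hq]), weingarten,
    Ring.inverse_mul_cancel_left _ _ (isUnit_omega _ (by simpa using hNk)), hpq]

theorem exists_brauerAction_eq_tracelessProjection (hN : n + m ≤ N) :
    ∃ q : Brauer n m, brauerAction N q = tracelessProjection n m N :=
  exists_brauerAction_eq hN tracelessProjection_mul_unitaryRep

/-- The relation `ρ(q) = 1` on traceless tensors, where only the permutation diagrams of `q`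
contribute. -/
theorem weingartenMixed_mul_omegaMixed (hN : 0 < N) (hNk : n + m ≤ N) :
    weingartenMixed n m N * omegaMixed n m N = 1 := by
  obtain ⟨q, hq⟩ := exists_brauerAction_eq_tracelessProjection hNk
  apply asAlgebraHom_permRep₀_injective hNk
  refine LinearMap.ext fun t => Subtype.ext ?_
  rw [asAlgebraHom_of_brauerAction hN (x := q), hq, tracelessProjection_of_mem t.2, map_one,
    Module.End.one_apply]
  intro σ
  rw [eq_thetaInv_of_brauerAction_eq hN hNk hq, thetaInv_apply, coeff_weingarten_mul_twist]

/-- An equivariant endomorphism of the traceless tensors, extended by `0` on their orthogonal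
complement, is given by an element of the walled Brauer algebra, whose permutation diagrams alone
act on traceless tensors. -/
theorem exists_asAlgebraHom_eq (hN : 0 < N) (hNk : n + m ≤ N)
    {T : Module.End ℂ (traceless n m N)}
    (hT : ∀ g : U N, T * unitaryRep₀ n m N g = unitaryRep₀ n m N g * T) :
    ∃ κ : MonoidAlgebra ℂ (S n m), T = (permRep₀ n m N).asAlgebraHom κ := by
  let A : Module.End ℂ (MixedTensor n m N) := (traceless n m N).subtype ∘ₗ T ∘ₗ
    (tracelessProjection n m N).codRestrict (traceless n m N) tracelessProjection_mem
  have hA : ∀ g : U N, A * unitaryRep n m N g = unitaryRep n m N g * A := by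
    intro g
    refine LinearMap.ext fun t => ?_
    have h1 : (tracelessProjection n m N).codRestrict (traceless n m N) tracelessProjection_mem
        (unitaryRep n m N g t) = unitaryRep₀ n m N g
          ((tracelessProjection n m N).codRestrict (traceless n m N) tracelessProjection_mem t) :=
      Subtype.ext (LinearMap.congr_fun (tracelessProjection_mul_unitaryRep g) t)
    change (T ((tracelessProjection n m N).codRestrict (traceless n m N) tracelessProjection_mem
        (unitaryRep n m N g t)) : MixedTensor n m N) = _
    rw [h1]
    exact congrArg Subtype.val (LinearMap.congr_fun (hT g) _)
  obtain ⟨x, hx⟩ := exists_brauerAction_eq hNk hA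
  refine ⟨MonoidAlgebra.ofCoeff (Finsupp.equivFunOnFinite.symm fun σ => x (permDiagram σ)), ?_⟩
  refine LinearMap.ext fun t => Subtype.ext ?_
  rw [asAlgebraHom_of_brauerAction hN (x := x) (fun σ => by simp), hx]
  have h2 : (tracelessProjection n m N).codRestrict (traceless n m N) tracelessProjection_mem t =
      t := Subtype.ext (tracelessProjection_of_mem t.2)
  change _ = (T ((tracelessProjection n m N).codRestrict (traceless n m N)
    tracelessProjection_mem t) : MixedTensor n m N)
  rw [h2]

end KSW

end

theorem mainTheorem7 (n m N : ℕ) (hn : 1 ≤ n) (hm : 1 ≤ m) (hN : n + m ≤ N) :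
    -- `Ω_{n+m}^N` is invertible, so that `Wg_{n+m}^N` is its inverse
    IsUnit (KSW.omega (Fin n ⊕ Fin m) N) ∧
    -- `Ω_{n,m}^N` is central
    (∀ x : MonoidAlgebra ℂ (KSW.S n m), KSW.omegaMixed n m N * x = x * KSW.omegaMixed n m N) ∧
    -- `Ω_{n,m}^N` is invertible and its inverse is the restriction of `Wg_{n+m}^N`
    KSW.omegaMixed n m N * KSW.weingartenMixed n m N = 1 ∧
    KSW.weingartenMixed n m N * KSW.omegaMixed n m N = 1 ∧
    -- an equivariant `T` is `ρ_N(κ)` for exactly one `κ`, namely `Wg_{n,m}^N * m_T`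
    (∀ T : Module.End ℂ (KSW.traceless n m N),
      (∀ g : KSW.U N, T * KSW.unitaryRep₀ n m N g = KSW.unitaryRep₀ n m N g * T) →
      ∀ κ : MonoidAlgebra ℂ (KSW.S n m),
        T = (KSW.permRep₀ n m N).asAlgebraHom κ ↔
          κ = KSW.weingartenMixed n m N * KSW.traceElement (KSW.permRep₀ n m N) T) ∧
    -- the element `q` of the walled Brauer algebra that represents the projection on traceless
    -- tensors exists, is unique, and is given by the two formulas
    (∃! q : KSW.Brauer n m, KSW.brauerAction N q = KSW.tracelessProjection n m N) ∧
    (∀ q : KSW.Brauer n m, KSW.brauerAction N q = KSW.tracelessProjection n m N →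
      q = KSW.brauerMul N (KSW.permToBrauer (KSW.omegaMixed n m N))
            (KSW.thetaInv (KSW.weingarten (Fin n ⊕ Fin m) N)) ∧
      q = KSW.brauerMul N (KSW.thetaInv (KSW.weingarten (Fin n ⊕ Fin m) N))
            (KSW.permToBrauer (KSW.omegaMixed n m N))) := by
  have hN0 : 0 < N := by omega
  have hcomm := KSW.traceElement_one_mul_comm (KSW.permRep₀ n m N)
  have hinv := KSW.weingartenMixed_mul_omegaMixed hN0 hN
  have hrec : ∀ κ, KSW.weingartenMixed n m N * KSW.traceElement (KSW.permRep₀ n m N)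
      ((KSW.permRep₀ n m N).asAlgebraHom κ) = κ := by
    intro κ
    rw [KSW.traceElement_asAlgebraHom, ← KSW.omegaMixed, ← mul_assoc, hinv, one_mul]
  refine ⟨KSW.isUnit_omega _ (by simpa using hN), hcomm, (hcomm _).trans hinv, hinv, ?_, ?_, ?_⟩
  · intro T hT κ
    obtain ⟨κ', rfl⟩ := KSW.exists_asAlgebraHom_eq hN0 hN hT
    rw [hrec, (KSW.asAlgebraHom_permRep₀_injective hN).eq_iff, eq_comm]
  · obtain ⟨q, hq⟩ := KSW.exists_brauerAction_eq_tracelessProjection hN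
    exact ⟨q, hq, fun q' hq' => KSW.brauerAction_injective hN (hq'.trans hq.symm)⟩
  · intro q hq
    have hwg := KSW.weingarten_mul_comm (Fin n ⊕ Fin m) N
    rw [KSW.brauerMul_permToBrauer_thetaInv hwg, KSW.brauerMul_thetaInv_permToBrauer hwg]
    exact ⟨KSW.eq_thetaInv_of_brauerAction_eq hN0 hN hq,
      KSW.eq_thetaInv_of_brauerAction_eq hN0 hN hq⟩
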